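/- Let $\mathcal X\subseteq\mathbb R^d$ be Borel, let $\pi(\theta)$ be a probability density on $\mathcal X$ with respect to Lebesgue measure (and write $\pi$ also for the distribution), let $q(\theta'\mid\theta)$ be a jointly measurable proposal density on $\mathcal X$, let $\mathcal W\subseteq[0,\infty)$, and let $\widetilde q$ be a probability distribution on $\mathcal W$ with $\int w\,\widetilde q(\mathrm dw)=1$ that does not depend on $\theta$. Put $\nu(\mathrm dw)=w\,\widetilde q(\mathrm dw)$ and $$r(\theta,\theta')=\frac{\pi(\theta')\,q(\theta\mid\theta')}{\pi(\theta)\,q(\theta'\mid\theta)},\qquad r(\theta)=\mathbb E_{\theta'\sim q(\cdot\mid\theta)}\big[r(\theta,\theta')\big].$$ Let $\mathsf P_{\mathrm{pm}}$ be the pseudo-marginal Metropolis--Hastings kernel on $\mathcal X\times\mathcal W$: from $(\theta,w)$ it proposes $\theta'\sim q(\cdot\mid\theta)$ and $w'\sim\widetilde q$, moves to $(\theta',w')$ with probability $1\wedge\{r(\theta,\theta')\,w'/w\}$, and otherwise stays at $(\theta,w)$. Its stationary distribution is $\mu=\pi\times\nu$. Define its left spectral gap by $$\epsilon^{\mathrm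 L}=1+\inf\Big\{\iint \mu(\mathrm dx)\,\mathsf P_{\mathrm{pm}}(x,\mathrm dy)\,f(x)f(y)\;:\;f\in L^2(\mu),\ \mathbb E_\mu[f]=0,\ \|f\|_{L^2(\mu)}=1\Big\}$$ (with $\epsilon^{\mathrm L}=1$, by convention, if there is no such $f$), and the asymptotic variance of $h\in L^2(\mu)$ by $$\mathsf{Var}_{\mathsf P_{\mathrm{pm}}}(h)=\lim_{n\to\infty} n\,\mathrm{Var}\Big(\frac1n\sum_{i=1}^n h(X_i)\Big)\in[0,\infty],$$ where $(X_i)_{i\ge1}$ is the Markov chain with kernel $\mathsf P_{\mathrm{pm}}$ and $X_1\sim\mu$. Suppose that $\epsilon^{\mathrm L}>0$, that $h(\theta,w)=h_*(\theta)$ with $h_*\in L^2(\pi)$, and that $r(\theta)\le c$ for $\pi$-almost all $\theta$, for some $c\in(0,\infty)$. Write $\bar h_*=h_*-\mathbb E_\pi[h_*]$ (so $\bar h_*=h_*$ if $h_*$ has $\pi$-mean zero). Then the limit defining $\mathsf{Var}_{\mathsf P_{\mathrm{pm}}}(h)$ exists in $[0,\infty]$ and $$\mathsf{Var}_{\mathsf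 P_{\mathrm{pm}}}(h)\;\ge\;-\frac{1}{\epsilon^{\mathrm L}}\,\|\bar h_*\|_{L^2(\pi)}^2+\frac{1}{2c}\,\|\bar h_*\|_{L^2(\pi)}^2\int_{\mathcal W} w^2\,\widetilde q(\mathrm dw),$$ with the convention $0\cdot\infty=0$. Consequently, if $h_*$ is not $\pi$-almost everywhere constant and $\mathbb E_{\widetilde q}[W^2]=\infty$, then $\mathsf{Var}_{\mathsf P_{\mathrm{pm}}}(h)=\infty$. -/

import Mathlib

open MeasureTheory ProbabilityTheory Filter Topology
open scoped ENNReal NNReal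

noncomputable section

namespace PseudoMarginal

/-! ## Markov chains, asymptotic variance, left spectral gap -/

section Chains

variable {S : Type*} [MeasurableSpace S]

/-- The law on `ℕ → S` of the Markov chain `X 0, X 1, …` with `X 0 ∼ μ` and transition kernel
`Q`. -/
def chainLaw (Q : Kernel S S) [IsMarkovKernel Q] (μ : Measure S) : Measure (ℕ → S) :=
  Kernel.trajMeasure (X := fun _ => S) μ
    (fun n => Q.comap (fun x : (i : Finset.Iic n) → S => x ⟨n, Finset.mem_Iic.2 le_rfl⟩)
      (measurable_pi_apply _))

/-- `n` times the variance of the ergodic average of `h` over `n` consecutive states of the chain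
started from `μ`. -/
def scaledVariance (Q : Kernel S S) [IsMarkovKernel Q] (μ : Measure S) (h : S → ℝ) (n : ℕ) :
    ℝ≥0∞ :=
  n * evariance (fun x : ℕ → S => (1 / (n : ℝ)) * ∑ i ∈ Finset.range n, h (x i)) (chainLaw Q μ)

/-- The asymptotic variance `Var_Q(h) = lim n · Var(n⁻¹ ∑ h(X_i))`, with values in `[0, ∞]`. -/
def asymptoticVariance (Q : Kernel S S) [IsMarkovKernel Q] (μ : Measure S) (h : S → ℝ) : ℝ≥0∞ :=
  limUnder atTop (scaledVariance Q μ h)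

/-- `1 + inf ∬ μ(dx) Q(x,dy) f(x) f(y)` over `f ∈ L²₀(μ)` with `‖f‖ = 1`. -/
def leftSpectralGap (Q : Kernel S S) (μ : Measure S) : ℝ :=
  1 + sInf {a : ℝ | ∃ f : S → ℝ, MemLp f 2 μ ∧ ∫ x, f x ∂μ = 0 ∧ ∫ x, f x ^ 2 ∂μ = 1 ∧
    a = ∫ z : S × S, f z.1 * f z.2 ∂(μ ⊗ₘ Q)}

/-- Propose `y ∼ κ(x, ·)`, move there with probability `α x y`, and otherwise stay at `x`. -/
def acceptReject (κ : Kernel S S) [IsSFiniteKernel κ] (α : S → S → ℝ≥0∞) : Kernel S S :=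
  κ.withDensity α +
    (Kernel.id : Kernel S S).withDensity (fun x _ => 1 - ∫⁻ y, α x y ∂(κ x))

theorem isMarkovKernel_acceptReject (κ : Kernel S S) [IsMarkovKernel κ] (α : S → S → ℝ≥0∞)
    (hα : Measurable (Function.uncurry α)) (h1 : ∀ x y, α x y ≤ 1) :
    IsMarkovKernel (acceptReject κ α) := by
  have hm : Measurable (Function.uncurry
      (fun x (_ : S) => 1 - ∫⁻ y, α x y ∂(κ x) : S → S → ℝ≥0∞)) := by
    have : Measurable (fun x => ∫⁻ y, α x y ∂(κ x)) := hα.lintegral_kernel_prod_right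
    exact (measurable_const.sub this).comp measurable_fst
  refine ⟨fun x => ⟨?_⟩⟩
  have hle : ∫⁻ y, α x y ∂(κ x) ≤ 1 := by
    calc ∫⁻ y, α x y ∂(κ x) ≤ ∫⁻ _, 1 ∂(κ x) := lintegral_mono (h1 x)
      _ = 1 := by simp
  rw [acceptReject, _root_.add_apply, Measure.add_apply, Kernel.withDensity_apply' _ hα,
    Kernel.withDensity_apply' _ hm]
  simp only [Measure.restrict_univ, lintegral_const, measure_univ, mul_one]
  exact add_tsub_cancel_of_le hle

end Chains

/-! ## The pseudo-marginal Metropolis-Hastings algorithm -/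

/-- The ingredients of the pseudo-marginal algorithm on a parameter space `X`, with reference
measure `dθ = lam`, and a noise space `W ⊆ [0, ∞)`. -/
structure Model (X : Type*) [MeasurableSpace X] (lam : Measure X) (W : Set ℝ≥0) where
  /-- the target density `π(θ)` -/
  dens : X → ℝ≥0
  measurable_dens : Measurable dens
  lintegral_dens : ∫⁻ θ, dens θ ∂lam = 1
  /-- the proposal density: `q θ θ'` is `q(θ' | θ)` -/
  q : X → X → ℝ≥0
  measurable_q : Measurable (Function.uncurry q)
  /-- the proposal kernel `q(θ' | θ) dθ'` -/
  proposal : Kernel X X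
  isMarkovKernel_proposal : IsMarkovKernel proposal
  proposal_eq : ∀ θ, proposal θ = lam.withDensity (fun θ' => q θ θ')
  /-- the law of the proposed multiplicative noise at `θ` -/
  noise : Kernel X W
  isMarkovKernel_noise : IsMarkovKernel noise
  /-- unbiasedness: the noise has expectation `1` -/
  unbiased : ∀ θ, ∫⁻ w, ((w : ℝ≥0) : ℝ≥0∞) ∂(noise θ) = 1

namespace Model

variable {X : Type*} [MeasurableSpace X] {lam : Measure X} {W : Set ℝ≥0} (M : Model X lam W)

instance : IsMarkovKernel M.proposal := M.isMarkovKernel_proposal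

instance : IsMarkovKernel M.noise := M.isMarkovKernel_noise

/-- The target distribution `π(dθ) = π(θ) dθ`. -/
def target : Measure X := lam.withDensity (fun θ => M.dens θ)

/-- The kernel `ν_θ(dw) = w q̃_θ(dw)`. -/
def nu : Kernel X W := M.noise.withDensity (fun _ w => ((w : ℝ≥0) : ℝ≥0∞))

/-- The stationary distribution `π(dθ) ν_θ(dw)` of the pseudo-marginal chain. -/
def stationary : Measure (X × W) := M.target ⊗ₘ M.nu

/-- The Metropolis-Hastings ratio `r(θ, θ') = π(θ') q(θ | θ') / (π(θ) q(θ' | θ))`, computed in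
`[0, ∞]`; its value where the denominator vanishes only matters on null sets. -/
def ratio (θ θ' : X) : ℝ≥0∞ :=
  ((M.dens θ' : ℝ≥0∞) * M.q θ' θ) / ((M.dens θ : ℝ≥0∞) * M.q θ θ')

/-- The expectation `r(θ)` of `r(θ, θ')` over `θ' ∼ q(· | θ)`. -/
def meanRatio (θ : X) : ℝ≥0∞ := ∫⁻ θ', M.ratio θ θ' ∂(M.proposal θ)

/-- The acceptance probability `1 ∧ (r(θ, θ') w' / w)`. -/
def accept (z z' : X × W) : ℝ≥0∞ :=
  min 1 (M.ratio z.1 z'.1 * (((z'.2 : ℝ≥0) : ℝ≥0∞) / ((z.2 : ℝ≥0) : ℝ≥0∞)))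

/-- The proposal on the extended space: `θ' ∼ q(· | θ)`, then `w' ∼ q̃_{θ'}`. -/
def extendedProposal : Kernel (X × W) (X × W) :=
  (M.proposal ⊗ₖ Kernel.prodMkLeft X M.noise).comap Prod.fst measurable_fst

instance : IsMarkovKernel M.extendedProposal := by
  unfold extendedProposal; infer_instance

/-- The pseudo-marginal Metropolis-Hastings kernel `P_pm`. -/
def pmKernel : Kernel (X × W) (X × W) := acceptReject M.extendedProposal M.accept

theorem measurable_accept : Measurable (Function.uncurry M.accept) := by
  have h1 := M.measurable_dens
  have h2 := M.measurable_q
  have h3 : Measurable (fun z : (X × W) × (X × W) => M.q z.1.1 z.2.1) :=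
    h2.comp (measurable_fst.fst.prodMk measurable_snd.fst)
  have h4 : Measurable (fun z : (X × W) × (X × W) => M.q z.2.1 z.1.1) :=
    h2.comp (measurable_snd.fst.prodMk measurable_fst.fst)
  unfold Function.uncurry accept ratio
  fun_prop

instance : IsMarkovKernel M.pmKernel :=
  isMarkovKernel_acceptReject _ _ M.measurable_accept (fun _ _ => min_le_left _ _)

end Model

end PseudoMarginal

end

/-! Write `P` for the transition operator on L²(μ), `f` for the centred function, `E = ‖f‖²` and
`S_n` for the sum of `f` over the first `n` states.

Existence of the limit: `‖S_n‖²` is, up to a linear term, a sum of partial sums of the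
autocovariances ⟨f, P^k f⟩. Reversibility makes the even ones equal to ‖P^m f‖², and the left
spectral gap makes each pair of lags 2m, 2m+1 contribute at least ε‖P^m f‖². So the partial sums
converge or tend to +∞, and averaging gives a limit `V`.

Lower bound: if `V` is finite, then 2(2⟨f,g⟩ − ⟨g,(1−P)g⟩) ≤ V + E for every `g` in L²(μ)
(`variational_bound`). The chain is sticky at large `w`: since the noise has mean 1, it leaves (θ,w)
with probability at most r(θ)/w ≤ c/w. Hence g = f(θ)·min(w,N)/(2c) has a small Dirichlet form,
while its correlation with `f` grows like ∫ w·min(w,N) dq̃. Letting N → ∞ gives E·∫w² dq̃ ≤ c(V + E)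
(`second_moment_le`).

What remains is (V + E)/2 ≤ V + E/ε. This is clear for ε ≤ 1; for ε ≥ 1 all autocovariances of `f`
are nonnegative, so V ≥ E. -/

noncomputable section

namespace PseudoMarginal

/-! ### Real sequences: averages and sums grouped in pairs -/

section Sequences

/-- Averages of a sequence tending to infinity tend to infinity. -/
theorem tendsto_cesaro_atTop {u : ℕ → ℝ} (hu : Tendsto u atTop atTop) :
    Tendsto (fun n : ℕ => (n : ℝ)⁻¹ * ∑ i ∈ Finset.range n, u i) atTop atTop := by
  rw [tendsto_atTop]
  intro b
  obtain ⟨N, hN⟩ := eventually_atTop.1 (tendsto_atTop.1 hu (b + 1))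
  have hlow : ∀ n ≥ N, ∑ i ∈ Finset.range N, u i + ((n : ℝ) - N) * (b + 1) ≤
      ∑ i ∈ Finset.range n, u i := by
    intro n hn
    induction n, hn using Nat.le_induction with
    | base => simp
    | succ n hn ih =>
      rw [Finset.sum_range_succ]
      push_cast
      linarith [hN n hn]
  obtain ⟨n₀, hn₀⟩ := exists_nat_ge (N * (b + 1) - ∑ i ∈ Finset.range N, u i)
  filter_upwards [eventually_ge_atTop N, eventually_ge_atTop n₀, eventually_gt_atTop 0]
    with n h1 h2 h3
  have h4 : (0 : ℝ) < n := by exact_mod_cast h3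
  have h5 : (n₀ : ℝ) ≤ n := by exact_mod_cast h2
  rw [inv_mul_eq_div, le_div_iff₀ h4]
  linarith [hlow n h1]

/-- If the sums over consecutive pairs `(2m, 2m+1)` are nonnegative and dominate the even terms,
then the partial sums of a sequence converge or tend to infinity. -/
theorem tendsto_sum_or_atTop {a : ℕ → ℝ} {δ : ℝ} (hδ : 0 < δ) (h0 : ∀ m, 0 ≤ a (2 * m))
    (hpair : ∀ m, δ * a (2 * m) ≤ a (2 * m) + a (2 * m + 1)) :
    (∃ l, Tendsto (fun n => ∑ i ∈ Finset.range (n + 1), a i) atTop (𝓝 l)) ∨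
      Tendsto (fun n => ∑ i ∈ Finset.range (n + 1), a i) atTop atTop := by
  have hpair0 : ∀ m, 0 ≤ a (2 * m) + a (2 * m + 1) := fun m =>
    (mul_nonneg hδ.le (h0 m)).trans (hpair m)
  have hstep : ∀ m, ∑ i ∈ Finset.range (2 * (m + 1)), a i =
      ∑ i ∈ Finset.range (2 * m), a i + (a (2 * m) + a (2 * m + 1)) := by
    intro m
    rw [mul_add, mul_one, Finset.sum_range_succ, Finset.sum_range_succ, add_assoc]
  have hmono : Monotone fun m => ∑ i ∈ Finset.range (2 * m), a i :=
    monotone_nat_of_le_succ fun m => by rw [hstep]; linarith [hpair0 m]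
  have hdiv : ∀ n : ℕ, n = 2 * (n / 2) ∨ n = 2 * (n / 2) + 1 := fun n => by omega
  have hhalf : Tendsto (fun n : ℕ => n / 2) atTop atTop := Nat.tendsto_div_const_atTop (by simp)
  rcases tendsto_atTop_of_monotone hmono with hT | ⟨l, hl⟩
  · right
    refine (tendsto_add_atTop_iff_nat (f := fun n => ∑ i ∈ Finset.range n, a i) 1).2 ?_
    refine tendsto_atTop_mono (fun n => ?_) (hT.comp hhalf)
    rcases hdiv n with h | h
    · conv_rhs => rw [h]
      exact le_rfl
    · conv_rhs => rw [h, Finset.sum_range_succ]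
      exact le_add_of_nonneg_right (h0 _)
  · left
    refine ⟨l, (tendsto_add_atTop_iff_nat (f := fun n => ∑ i ∈ Finset.range n, a i) 1).2 ?_⟩
    -- Convergence along even lengths forces the pair sums, hence the even terms, to zero. An
    -- odd-length partial sum exceeds the preceding even-length one by an even term, so it has the
    -- same limit.
    have hc : Tendsto (fun m => a (2 * m) + a (2 * m + 1)) atTop (𝓝 0) := by
      have := ((tendsto_add_atTop_iff_nat 1).2 hl).sub hl
      rw [sub_self] at this
      refine this.congr fun m => ?_
      rw [hstep]; ring
    have he : Tendsto (fun m => a (2 * m)) atTop (𝓝 0) := by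
      refine squeeze_zero h0 (fun m => ?_) (by simpa using hc.const_mul δ⁻¹)
      rw [inv_mul_eq_div, le_div_iff₀ hδ, mul_comm]
      exact hpair m
    have h1 := hl.comp hhalf
    have h2 := h1.add (he.comp hhalf)
    rw [add_zero] at h2
    refine tendsto_of_tendsto_of_tendsto_of_le_of_le h1 h2 (fun n => ?_) (fun n => ?_)
    · rcases hdiv n with h | h
      · conv_rhs => rw [h]
        exact le_rfl
      · conv_rhs => rw [h, Finset.sum_range_succ]
        exact le_add_of_nonneg_right (h0 _)
    · rcases hdiv n with h | h
      · conv_lhs => rw [h]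
        exact le_add_of_nonneg_right (h0 _)
      · conv_lhs => rw [h, Finset.sum_range_succ]
        exact le_rfl

end Sequences

/-! ### Symmetric contractions: growth of sums and the variational bound -/

section Hilbert

variable {H K : Type*} [NormedAddCommGroup H] [InnerProductSpace ℝ H] [NormedAddCommGroup K]
  [InnerProductSpace ℝ K]

local notation "⟪" x ", " y "⟫" => inner ℝ x y

/-- `J` realises the powers of the symmetric contraction `P` as correlations of a stationary
sequence of isometric copies. -/
structure IsDilation (P : H →L[ℝ] H) (J : ℕ → H →ₗᵢ[ℝ] K) : Prop where
  symm : ∀ f g, ⟪P f, g⟫ = ⟪f, P g⟫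
  norm_le : ∀ f, ‖P f‖ ≤ ‖f‖
  inner_eq : ∀ i k f g, ⟪J i f, J (i + k) g⟫ = ⟪f, (P ^ k) g⟫

namespace IsDilation

variable {P : H →L[ℝ] H} {J : ℕ → H →ₗᵢ[ℝ] K} (D : IsDilation P J)
include D

theorem pow_symm (k : ℕ) (f g : H) : ⟪(P ^ k) f, g⟫ = ⟪f, (P ^ k) g⟫ := by
  induction k generalizing f g with
  | zero => simp
  | succ k ih =>
    have h1 : (P ^ (k + 1)) f = (P ^ k) (P f) := by rw [pow_succ, mul_apply_eq_comp]
    have h2 : (P ^ (k + 1)) g = P ((P ^ k) g) := by rw [pow_succ', mul_apply_eq_comp]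
    rw [h1, h2, ih, D.symm]

theorem pow_norm_le (k : ℕ) (f : H) : ‖(P ^ k) f‖ ≤ ‖f‖ := by
  induction k generalizing f with
  | zero => simp
  | succ k ih =>
    rw [pow_succ', mul_apply_eq_comp]
    exact (D.norm_le _).trans (ih f)

theorem inner_pow_two_mul (m : ℕ) (f : H) : ⟪f, (P ^ (2 * m)) f⟫ = ‖(P ^ m) f‖ ^ 2 := by
  rw [two_mul, pow_add, mul_apply_eq_comp, ← D.pow_symm, real_inner_self_eq_norm_sq]

theorem inner_pow_two_mul_add_one (m : ℕ) (f : H) :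
    ⟪f, (P ^ (2 * m + 1)) f⟫ = ⟪(P ^ m) f, P ((P ^ m) f)⟫ := by
  rw [D.pow_symm, two_mul, add_assoc, pow_add, pow_succ', mul_apply_eq_comp,
    mul_apply_eq_comp]

/-- Expand the square by its larger index: the n-th copy meets the earlier ones at lags 1, …, n, and
the lag-zero term, which the doubled sum counts twice, is corrected by −‖f‖². In this form division
by `n` is a Cesàro average. -/
theorem norm_sum_sq (f : H) (n : ℕ) :
    ‖∑ i ∈ Finset.range n, J i f‖ ^ 2 =
      ∑ m ∈ Finset.range n, (2 * ∑ k ∈ Finset.range (m + 1), ⟪f, (P ^ k) f⟫ - ‖f‖ ^ 2) := by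
  induction n with
  | zero => simp
  | succ n ih =>
    rw [Finset.sum_range_succ, Finset.sum_range_succ (n := n), norm_add_sq_real, ih,
      LinearIsometry.norm_map, sum_inner]
    have h1 : ∑ i ∈ Finset.range n, ⟪J i f, J n f⟫ =
        ∑ k ∈ Finset.range n, ⟪f, (P ^ (k + 1)) f⟫ := by
      rw [← Finset.sum_range_reflect]
      refine Finset.sum_congr rfl fun i hi => ?_
      have hi' := Finset.mem_range.1 hi
      rw [← D.inner_eq (n - 1 - i) (i + 1) f f]
      congr 3
      omega
    rw [h1, Finset.sum_range_succ']
    simp only [pow_zero, one_apply_eq_self, real_inner_self_eq_norm_sq]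
    ring

theorem tendsto_norm_sum_sq {f : H} {δ : ℝ} (hδ : 0 < δ)
    (hgap : ∀ m, (δ - 1) * ‖(P ^ m) f‖ ^ 2 ≤ ⟪(P ^ m) f, P ((P ^ m) f)⟫) :
    (∃ V, Tendsto (fun n : ℕ => (n : ℝ)⁻¹ * ‖∑ i ∈ Finset.range n, J i f‖ ^ 2) atTop (𝓝 V)) ∨
      Tendsto (fun n : ℕ => (n : ℝ)⁻¹ * ‖∑ i ∈ Finset.range n, J i f‖ ^ 2) atTop atTop := by
  simp_rw [D.norm_sum_sq]
  rcases tendsto_sum_or_atTop (a := fun k => ⟪f, (P ^ k) f⟫) hδ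
    (fun m => by rw [D.inner_pow_two_mul]; positivity)
    (fun m => by
      rw [D.inner_pow_two_mul, D.inner_pow_two_mul_add_one]; linarith [hgap m]) with ⟨l, hl⟩ | hl
  · exact Or.inl ⟨_, ((hl.const_mul 2).sub_const (‖f‖ ^ 2)).cesaro⟩
  · exact Or.inr (tendsto_cesaro_atTop
      (tendsto_atTop_add_const_right _ _ (hl.const_mul_atTop two_pos)))

theorem le_norm_sum_sq {f : H} (hpos : ∀ m, 0 ≤ ⟪(P ^ m) f, P ((P ^ m) f)⟫) (n : ℕ) :
    n * ‖f‖ ^ 2 ≤ ‖∑ i ∈ Finset.range n, J i f‖ ^ 2 := by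
  have h0 : ∀ k, 0 ≤ ⟪f, (P ^ k) f⟫ := by
    intro k
    rcases Nat.even_or_odd' k with ⟨m, rfl | rfl⟩
    · rw [D.inner_pow_two_mul]; positivity
    · rw [D.inner_pow_two_mul_add_one]; exact hpos m
  rw [D.norm_sum_sq, ← nsmul_eq_mul, ← Finset.card_range n, ← Finset.sum_const,
    Finset.card_range]
  refine Finset.sum_le_sum fun m _ => ?_
  rw [Finset.sum_range_succ', pow_zero, one_apply_eq_self, real_inner_self_eq_norm_sq]
  linarith [Finset.sum_nonneg fun k (_ : k ∈ Finset.range m) => h0 (k + 1)]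

/-- A version of the variational principle at finite `n`, without resolvent or spectral theorem. `T`
is a positive operator and T(1 − P) is `n` up to a boundary term, so positivity of ⟨u, T u⟩ at u = f
− (1 − P)g gives the claim once the boundary terms are bounded. -/
theorem variational_bound_aux (f g : H) (n : ℕ) :
    2 * (n * (2 * ⟪f, g⟫ - ⟪g, g - P g⟫) - 2 * (‖∑ i ∈ Finset.range n, J i f‖ * ‖g‖) -
      2 * ‖g‖ ^ 2) ≤ ‖∑ i ∈ Finset.range n, J i f‖ ^ 2 + n * ‖f‖ ^ 2 := by
  let G : ℕ → H →L[ℝ] H := fun m => ∑ k ∈ Finset.range m, P ^ k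
  let T : H →L[ℝ] H := ∑ m ∈ Finset.range n, G (m + 1)
  have hT : ∀ u, ‖∑ i ∈ Finset.range n, J i u‖ ^ 2 = 2 * ⟪u, T u⟫ - n * ‖u‖ ^ 2 := by
    intro u
    rw [D.norm_sum_sq]
    simp only [T, G, sum_apply, inner_sum, Finset.sum_sub_distrib,
      Finset.mul_sum, Finset.sum_const, Finset.card_range, nsmul_eq_mul]
  have hG : ∀ m, G m * (1 - P) = 1 - P ^ m := fun m => geom_sum_mul_neg P m
  have hTP : T * (1 - P) = n • 1 - P * G n := by
    simp only [T, Finset.sum_mul, hG, Finset.sum_sub_distrib, Finset.sum_const, Finset.card_range,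
      G, Finset.mul_sum, pow_succ']
  have hsym : ∀ u v, ⟪T u, v⟫ = ⟪u, T v⟫ := by
    intro u v
    simp only [T, G, sum_apply, inner_sum, sum_inner, D.pow_symm]
  have hTg : T (g - P g) = (n : ℝ) • g - P (G n g) := by
    have := congrArg (fun A : H →L[ℝ] H => A g) hTP
    simpa [mul_apply_eq_comp, Nat.cast_smul_eq_nsmul] using this
  -- `T` is positive because 2⟨u, T u⟩ is a squared norm plus n‖u‖².
  have hpos : 0 ≤ ⟪f - (g - P g), T (f - (g - P g))⟫ := by
    have h1 := hT (f - (g - P g))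
    nlinarith [sq_nonneg ‖∑ i ∈ Finset.range n, J i (f - (g - P g))‖,
      mul_nonneg (Nat.cast_nonneg n : (0 : ℝ) ≤ n) (sq_nonneg ‖f - (g - P g)‖)]
  have hcross : ⟪g - P g, T f⟫ = ⟪f, T (g - P g)⟫ := by rw [← hsym, real_inner_comm]
  rw [map_sub, inner_sub_left, inner_sub_right, inner_sub_right, hcross, hTg, inner_sub_right,
    inner_sub_right, inner_smul_right, inner_smul_right] at hpos
  -- In the dilation this boundary term is the inner product of the copy of `P g` at time 0 with the
  -- whole sum; Cauchy–Schwarz makes it o(n) when the variance limit is finite.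
  have h2 : ⟪f, P (G n g)⟫ ≤ ‖∑ i ∈ Finset.range n, J i f‖ * ‖g‖ := by
    have h3 : ⟪f, P (G n g)⟫ = ⟪J 0 (P g), ∑ i ∈ Finset.range n, J i f⟫ := by
      have h4 : ∀ i, ⟪J 0 (P g), J i f⟫ = ⟪f, P ((P ^ i) g)⟫ := by
        intro i
        have := D.inner_eq 0 i (P g) f
        rw [zero_add] at this
        rw [this, ← D.pow_symm, real_inner_comm, ← mul_apply_eq_comp,
          ← mul_apply_eq_comp, ← pow_succ, ← pow_succ']
      simp only [inner_sum, h4, G, sum_apply, map_sum]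
    rw [h3]
    refine (real_inner_le_norm _ _).trans ?_
    rw [LinearIsometry.norm_map, mul_comm]
    exact mul_le_mul_of_nonneg_left (D.norm_le g) (norm_nonneg _)
  -- Moving `G n` across, the geometric sum telescopes to 1 − P^n, so this term stays bounded in
  -- `n`.
  have h5 : -(2 * ‖g‖ ^ 2) ≤ ⟪g - P g, P (G n g)⟫ := by
    have h6 : ⟪g - P g, P (G n g)⟫ = ⟪P g, g⟫ - ⟪P g, (P ^ n) g⟫ := by
      have hs : ∀ u v, ⟪G n u, v⟫ = ⟪u, G n v⟫ := by
        intro u v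
        simp only [G, sum_apply, inner_sum, sum_inner, D.pow_symm]
      have h7 : G n (g - P g) = g - (P ^ n) g := by
        have := congrArg (fun A : H →L[ℝ] H => A g) (hG n)
        simpa [mul_apply_eq_comp] using this
      have hcomm : P (G n g) = G n (P g) := by
        simp only [G, sum_apply, map_sum]
        refine Finset.sum_congr rfl fun k _ => ?_
        rw [← mul_apply_eq_comp, ← mul_apply_eq_comp, ← pow_succ,
          ← pow_succ']
      rw [hcomm, ← hs, h7, inner_sub_left, real_inner_comm, real_inner_comm ((P ^ n) g)]
    rw [h6]
    have h8 := abs_real_inner_le_norm (P g) g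
    have h9 := abs_real_inner_le_norm (P g) ((P ^ n) g)
    have h10 := mul_le_mul (D.norm_le g) (D.pow_norm_le n g) (norm_nonneg _) (norm_nonneg g)
    have h11 := mul_le_mul_of_nonneg_right (D.norm_le g) (norm_nonneg g)
    have h12 := neg_abs_le ⟪P g, g⟫
    have h13 := le_abs_self ⟪P g, (P ^ n) g⟫
    nlinarith
  rw [real_inner_comm g (g - P g)] at hpos
  nlinarith [hT f]

/-- Variational lower bound for the asymptotic variance. -/
theorem variational_bound {f : H} {V : ℝ}
    (hV : Tendsto (fun n : ℕ => (n : ℝ)⁻¹ * ‖∑ i ∈ Finset.range n, J i f‖ ^ 2) atTop (𝓝 V))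
    (g : H) : 2 * (2 * ⟪f, g⟫ - ⟪g, g - P g⟫) ≤ V + ‖f‖ ^ 2 := by
  have hinv : Tendsto (fun n : ℕ => (n : ℝ)⁻¹) atTop (𝓝 0) := tendsto_inv_atTop_nhds_zero_nat
  -- The term is the square root of (‖S_n‖²/n)·(1/n), and the first factor converges.
  have hs : Tendsto (fun n : ℕ => (n : ℝ)⁻¹ * ‖∑ i ∈ Finset.range n, J i f‖) atTop (𝓝 0) := by
    have h1 := (hV.mul hinv).sqrt
    rw [mul_zero, Real.sqrt_zero] at h1
    refine h1.congr fun n => ?_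
    rw [← Real.sqrt_sq (by positivity : 0 ≤ (n : ℝ)⁻¹ * ‖∑ i ∈ Finset.range n, J i f‖)]
    congr 1
    ring
  have hl : Tendsto (fun n : ℕ => 2 * (2 * ⟪f, g⟫ - ⟪g, g - P g⟫ -
      2 * ((n : ℝ)⁻¹ * ‖∑ i ∈ Finset.range n, J i f‖ * ‖g‖) - (n : ℝ)⁻¹ * (2 * ‖g‖ ^ 2)))
      atTop (𝓝 (2 * (2 * ⟪f, g⟫ - ⟪g, g - P g⟫ - 2 * (0 * ‖g‖) - 0 * (2 * ‖g‖ ^ 2)))) :=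
    (((hs.mul_const _).const_mul 2).const_sub _ |>.sub (hinv.mul_const _)).const_mul 2
  refine (le_of_tendsto_of_tendsto hl (hV.add_const (‖f‖ ^ 2)) ?_).trans' (by simp)
  filter_upwards [eventually_gt_atTop 0] with n hn
  have hn' : (0 : ℝ) < n := by exact_mod_cast hn
  have h1 := mul_le_mul_of_nonneg_left (D.variational_bound_aux f g n) (inv_nonneg.2 hn'.le)
  have h2 : (n : ℝ)⁻¹ * n = 1 := inv_mul_cancel₀ hn'.ne'
  linear_combination h1 + (‖f‖ ^ 2 - 2 * (2 * ⟪f, g⟫ - ⟪g, g - P g⟫)) * h2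

end IsDilation

end Hilbert

/-! ### The transition operator and the stationary path law of a reversible chain -/

section ReversibleChains

variable {S : Type*} [MeasurableSpace S] {Q : Kernel S S} [IsMarkovKernel Q] {μ : Measure S}
  [IsProbabilityMeasure μ]

local notation "⟪" x ", " y "⟫" => inner ℝ x y

theorem inner_Lp_two {α : Type*} [MeasurableSpace α] {ρ : Measure α} (f g : Lp ℝ 2 ρ) :
    ⟪f, g⟫ = ∫ x, f x * g x ∂ρ := by
  rw [L2.inner_def]
  exact integral_congr_ae (.of_forall fun x => by simp [mul_comm])

theorem ofReal_norm_sq_Lp_two {α : Type*} [MeasurableSpace α] {ρ : Measure α} (f : Lp ℝ 2 ρ) :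
    ENNReal.ofReal (‖f‖ ^ 2) = ∫⁻ x, ‖f x‖ₑ ^ 2 ∂ρ := by
  rw [← real_inner_self_eq_norm_sq, inner_Lp_two, ofReal_integral_eq_lintegral_ofReal]
  · refine lintegral_congr fun x => ?_
    rw [← sq, ← sq_abs, ENNReal.ofReal_pow (abs_nonneg _), ← Real.enorm_eq_ofReal_abs]
  · simpa [sq] using (Lp.memLp f).integrable_sq
  · exact .of_forall fun x => mul_self_nonneg _

theorem measurePreserving_fst_compProd (κ : Kernel S S) [IsMarkovKernel κ] :
    MeasurePreserving Prod.fst (μ ⊗ₘ κ) μ :=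
  ⟨measurable_fst, Measure.fst_compProd μ κ⟩

theorem integrable_integral_compProd {α β : Type*} [MeasurableSpace α] [MeasurableSpace β]
    {ρ : Measure α} [SFinite ρ] {κ : Kernel α β} [IsSFiniteKernel κ] {f : α × β → ℝ}
    (hf : Integrable f (ρ ⊗ₘ κ)) : Integrable (fun x => ∫ y, f (x, y) ∂(κ x)) ρ :=
  MeasureTheory.Integrable.integral_compProd (κ := Kernel.const Unit ρ)
    (η := Kernel.prodMkLeft Unit κ) (a := ()) hf

/-- The transition operator on `L²(μ)` of a kernel that is reversible with respect to `μ`. -/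
def transitionOp (hrev : MeasurePreserving Prod.swap (μ ⊗ₘ Q) (μ ⊗ₘ Q)) :
    Lp ℝ 2 μ →L[ℝ] Lp ℝ 2 μ :=
  (Lp.compMeasurePreservingₗᵢ ℝ Prod.fst
    (measurePreserving_fst_compProd (μ := μ) Q)).toContinuousLinearMap.adjoint ∘L
  (Lp.compMeasurePreservingₗᵢ ℝ Prod.snd
    ((measurePreserving_fst_compProd (μ := μ) Q).comp hrev)).toContinuousLinearMap

theorem integrable_mul_compProd (hrev : MeasurePreserving Prod.swap (μ ⊗ₘ Q) (μ ⊗ₘ Q))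
    {f g : S → ℝ} (hf : MemLp f 2 μ) (hg : MemLp g 2 μ) :
    Integrable (fun z : S × S => f z.1 * g z.2) (μ ⊗ₘ Q) :=
  (hf.comp_measurePreserving (measurePreserving_fst_compProd Q)).integrable_mul
    (hg.comp_measurePreserving ((measurePreserving_fst_compProd Q).comp hrev))

theorem inner_transitionOp (hrev : MeasurePreserving Prod.swap (μ ⊗ₘ Q) (μ ⊗ₘ Q))
    (f g : Lp ℝ 2 μ) : ⟪f, transitionOp hrev g⟫ = ∫ z, f z.1 * g z.2 ∂(μ ⊗ₘ Q) := by
  rw [transitionOp, ContinuousLinearMap.comp_apply, ContinuousLinearMap.adjoint_inner_right,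
    inner_Lp_two]
  refine integral_congr_ae ?_
  filter_upwards [Lp.coeFn_compMeasurePreserving f
    (measurePreserving_fst_compProd (μ := μ) Q), Lp.coeFn_compMeasurePreserving g
    ((measurePreserving_fst_compProd (μ := μ) Q).comp hrev)] with z h1 h2
  exact congrArg₂ (· * ·) h1 h2

theorem transitionOp_symm (hrev : MeasurePreserving Prod.swap (μ ⊗ₘ Q) (μ ⊗ₘ Q))
    (f g : Lp ℝ 2 μ) : ⟪transitionOp hrev f, g⟫ = ⟪f, transitionOp hrev g⟫ := by
  rw [real_inner_comm, inner_transitionOp, inner_transitionOp,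
    ← hrev.integral_comp MeasurableEquiv.prodComm.measurableEmbedding]
  exact integral_congr_ae (.of_forall fun z => mul_comm _ _)

theorem norm_transitionOp_le (hrev : MeasurePreserving Prod.swap (μ ⊗ₘ Q) (μ ⊗ₘ Q))
    (f : Lp ℝ 2 μ) : ‖transitionOp hrev f‖ ≤ ‖f‖ := by
  rw [transitionOp, ContinuousLinearMap.comp_apply]
  refine (ContinuousLinearMap.le_opNorm _ _).trans ?_
  rw [ContinuousLinearMap.adjoint.norm_map, LinearIsometry.coe_toContinuousLinearMap,
    LinearIsometry.norm_map]
  exact mul_le_of_le_one_left (norm_nonneg _) (LinearIsometry.norm_toContinuousLinearMap_le _)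

/-- Both functions have the same integral over every measurable set: test the bilinear form against
indicators. -/
theorem transitionOp_ae_eq (hrev : MeasurePreserving Prod.swap (μ ⊗ₘ Q) (μ ⊗ₘ Q))
    (g : Lp ℝ 2 μ) : transitionOp hrev g =ᵐ[μ] fun x => ∫ y, g y ∂(Q x) := by
  have hone : MemLp (fun _ : S => (1 : ℝ)) 2 μ := memLp_const 1
  have hint : Integrable (fun z : S × S => g z.2) (μ ⊗ₘ Q) := by
    simpa using integrable_mul_compProd hrev hone (Lp.memLp g)
  refine Integrable.ae_eq_of_forall_setIntegral_eq _ _ ((Lp.memLp _).integrable one_le_two)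
    (integrable_integral_compProd hint) fun s hs hμs => ?_
  rw [← L2.inner_indicatorConstLp_one (𝕜 := ℝ) hs hμs.ne, inner_transitionOp,
    Measure.integral_compProd (integrable_mul_compProd hrev (Lp.memLp _) (Lp.memLp _)),
    ← integral_indicator hs]
  refine integral_congr_ae ?_
  filter_upwards [indicatorConstLp_coeFn (p := 2) (hs := hs) (hμs := hμs.ne) (c := (1 : ℝ))]
    with x hx
  simp only [hx, integral_const_mul]
  by_cases h : x ∈ s <;> simp [h]

theorem map_prodMap_compProd_comap {α : Type*} [MeasurableSpace α] (ρ : Measure α) [SFinite ρ]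
    {e : α → S} (he : Measurable e) :
    (ρ ⊗ₘ Q.comap e he).map (Prod.map e id) = ρ.map e ⊗ₘ Q := by
  ext s hs
  rw [Measure.map_apply (he.prodMap measurable_id) hs,
    Measure.compProd_apply (he.prodMap measurable_id hs), Measure.compProd_apply hs,
    lintegral_map (Kernel.measurable_kernel_prodMk_left hs) he]
  rfl

instance : IsProbabilityMeasure (chainLaw Q μ) := by
  unfold chainLaw; infer_instance

theorem chainLaw_compProd (n : ℕ) :
    (chainLaw Q μ).map (Preorder.frestrictLe n) ⊗ₘ
      Q.comap (fun x : (i : Finset.Iic n) → S => x ⟨n, Finset.mem_Iic.2 le_rfl⟩)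
        (measurable_pi_apply _) =
      (chainLaw Q μ).map (fun x => (Preorder.frestrictLe n x, x (n + 1))) :=
  Kernel.map_frestrictLe_trajMeasure_compProd_eq_map_trajMeasure (X := fun _ => S)

omit [IsProbabilityMeasure μ] in
theorem chainLaw_map_zero : (chainLaw Q μ).map (fun x => x 0) = μ := by
  have h1 : (chainLaw Q μ).map (Preorder.frestrictLe 0) =
      μ.map (MeasurableEquiv.piUnique (fun _ : Finset.Iic 0 => S)).symm := by
    rw [chainLaw, Kernel.trajMeasure, Measure.map_comp _ _ (by fun_prop),
      Kernel.traj_map_frestrictLe, Kernel.partialTraj_self]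
    exact Measure.id_comp
  have h2 : (fun x : ℕ → S => x 0) = (fun y : (i : Finset.Iic 0) → S =>
      y ⟨0, Finset.mem_Iic.2 le_rfl⟩) ∘ Preorder.frestrictLe 0 := rfl
  rw [h2, ← Measure.map_map (measurable_pi_apply _) (by fun_prop), h1,
    Measure.map_map (measurable_pi_apply _) (by fun_prop)]
  exact Measure.map_id

theorem chainLaw_map_succ (n : ℕ) :
    (chainLaw Q μ).map (fun x => (x n, x (n + 1))) =
      (chainLaw Q μ).map (fun x => x n) ⊗ₘ Q := by
  have h1 := map_prodMap_compProd_comap (Q := Q)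
    ((chainLaw Q μ).map (Preorder.frestrictLe (π := fun _ => S) n))
    (e := fun x : (i : Finset.Iic n) → S => x ⟨n, Finset.mem_Iic.2 le_rfl⟩)
    (measurable_pi_apply _)
  rw [chainLaw_compProd, Measure.map_map (by fun_prop) (by fun_prop),
    Measure.map_map (by fun_prop) (by fun_prop)] at h1
  exact h1

/-- Reversibility makes the two marginals of μ ⊗ Q agree, so `μ` is stationary and passes from each
time to the next. -/
theorem measurePreserving_eval_chainLaw (hrev : MeasurePreserving Prod.swap (μ ⊗ₘ Q) (μ ⊗ₘ Q))
    (n : ℕ) : MeasurePreserving (fun x : ℕ → S => x n) (chainLaw Q μ) μ := by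
  refine ⟨by fun_prop, ?_⟩
  induction n with
  | zero => exact chainLaw_map_zero
  | succ n ih =>
    have h1 := chainLaw_map_succ (Q := Q) (μ := μ) n
    rw [ih] at h1
    have h2 := ((measurePreserving_fst_compProd (μ := μ) Q).comp hrev).map_eq
    rw [← h1, Measure.map_map (by fun_prop) (by fun_prop)] at h2
    exact h2

/-- The `n`-th state of the chain as an isometry from `L²(μ)` into `L²` of the path space. -/
def evalIsometry (hrev : MeasurePreserving Prod.swap (μ ⊗ₘ Q) (μ ⊗ₘ Q)) (n : ℕ) :
    Lp ℝ 2 μ →ₗᵢ[ℝ] Lp ℝ 2 (chainLaw Q μ) :=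
  Lp.compMeasurePreservingₗᵢ ℝ _ (measurePreserving_eval_chainLaw hrev n)

theorem evalIsometry_ae_eq (hrev : MeasurePreserving Prod.swap (μ ⊗ₘ Q) (μ ⊗ₘ Q)) (n : ℕ)
    (f : Lp ℝ 2 μ) : evalIsometry hrev n f =ᵐ[chainLaw Q μ] fun x => f (x n) :=
  Lp.coeFn_compMeasurePreserving f (measurePreserving_eval_chainLaw hrev n)

/-- The Markov property: conditioning on the states up to time `n` replaces g(X_{n+1}) by (Pg)(X_n).
Iterating it produces the powers of `P` in the dilation. -/
theorem inner_evalIsometry_succ (hrev : MeasurePreserving Prod.swap (μ ⊗ₘ Q) (μ ⊗ₘ Q))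
    {i n : ℕ} (hin : i ≤ n) (f g : Lp ℝ 2 μ) :
    ⟪evalIsometry hrev i f, evalIsometry hrev (n + 1) g⟫ =
      ⟪evalIsometry hrev i f, evalIsometry hrev n (transitionOp hrev g)⟫ := by
  have hmi := measurePreserving_eval_chainLaw hrev i
  have hmn := measurePreserving_eval_chainLaw hrev (n + 1)
  have hprod : Integrable (fun x : ℕ → S => f (x i) * g (x (n + 1))) (chainLaw Q μ) :=
    ((Lp.memLp f).comp_measurePreserving hmi).integrable_mul
      ((Lp.memLp g).comp_measurePreserving hmn)
  let F : ((j : Finset.Iic n) → S) × S → ℝ := fun z => f (z.1 ⟨i, Finset.mem_Iic.2 hin⟩) * g z.2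
  have hpair : Measurable (fun x : ℕ → S => (Preorder.frestrictLe (π := fun _ => S) n x,
      x (n + 1))) := by fun_prop
  have hF : StronglyMeasurable F :=
    ((Lp.stronglyMeasurable f).comp_measurable ((measurable_pi_apply _).comp measurable_fst)).mul
      ((Lp.stronglyMeasurable g).comp_measurable measurable_snd)
  have hFint : Integrable F ((chainLaw Q μ).map
      (fun x => (Preorder.frestrictLe (π := fun _ => S) n x, x (n + 1)))) :=
    (integrable_map_measure hF.aestronglyMeasurable hpair.aemeasurable).2 hprod
  have hL : ⟪evalIsometry hrev i f, evalIsometry hrev (n + 1) g⟫ =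
      ∫ x, f (x i) * g (x (n + 1)) ∂(chainLaw Q μ) := by
    rw [inner_Lp_two]
    refine integral_congr_ae ?_
    filter_upwards [evalIsometry_ae_eq hrev i f, evalIsometry_ae_eq hrev (n + 1) g] with x h1 h2
    rw [h1, h2]
  have hR : ⟪evalIsometry hrev i f, evalIsometry hrev n (transitionOp hrev g)⟫ =
      ∫ x, f (x i) * ∫ y, g y ∂(Q (x n)) ∂(chainLaw Q μ) := by
    rw [inner_Lp_two]
    refine integral_congr_ae ?_
    filter_upwards [evalIsometry_ae_eq hrev i f,
      evalIsometry_ae_eq hrev n (transitionOp hrev g),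
      (measurePreserving_eval_chainLaw hrev n).quasiMeasurePreserving.ae_eq_comp
        (transitionOp_ae_eq hrev g)] with x h1 h2 h3
    rw [h1, h2]
    exact congrArg _ h3
  rw [hL, hR]
  have h1 : ∫ x, f (x i) * g (x (n + 1)) ∂(chainLaw Q μ) = ∫ z, F z ∂((chainLaw Q μ).map
      (fun x => (Preorder.frestrictLe (π := fun _ => S) n x, x (n + 1)))) :=
    (integral_map hpair.aemeasurable hF.aestronglyMeasurable).symm
  have hkey := chainLaw_compProd (Q := Q) (μ := μ) n
  rw [h1]
  rw [← hkey] at hFint ⊢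
  rw [Measure.integral_compProd hFint]
  have hmeas := (integrable_integral_compProd hFint).aestronglyMeasurable
  rw [integral_map (by fun_prop) hmeas]
  refine integral_congr_ae (.of_forall fun x => ?_)
  simp only [F, integral_const_mul]
  rfl

theorem isDilation_evalIsometry (hrev : MeasurePreserving Prod.swap (μ ⊗ₘ Q) (μ ⊗ₘ Q)) :
    IsDilation (transitionOp hrev) (evalIsometry hrev) where
  symm := transitionOp_symm hrev
  norm_le := norm_transitionOp_le hrev
  inner_eq i k f g := by
    induction k generalizing g with
    | zero => simp [LinearIsometry.inner_map_map]
    | succ k ih =>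
      rw [← add_assoc, inner_evalIsometry_succ hrev (Nat.le_add_right i k), ih, pow_succ,
        mul_apply_eq_comp]

end ReversibleChains

/-! ### Spectral gap, Dirichlet form and asymptotic variance -/

section AsymptoticVariance

variable {S : Type*} [MeasurableSpace S] {Q : Kernel S S} [IsMarkovKernel Q] {μ : Measure S}
  [IsProbabilityMeasure μ]

local notation "⟪" x ", " y "⟫" => inner ℝ x y

theorem integral_comp_measurePreserving {α β : Type*} [MeasurableSpace α] [MeasurableSpace β]
    {ρ : Measure α} {ρ' : Measure β} {e : α → β} (he : MeasurePreserving e ρ ρ') {f : β → ℝ}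
    (hf : AEStronglyMeasurable f ρ') : ∫ x, f (e x) ∂ρ = ∫ y, f y ∂ρ' := by
  have h := integral_map he.aemeasurable (f := f) (by rwa [he.map_eq])
  rw [he.map_eq] at h
  exact h.symm

theorem leftSpectralGap_sub_one_le (hrev : MeasurePreserving Prod.swap (μ ⊗ₘ Q) (μ ⊗ₘ Q))
    {f : Lp ℝ 2 μ} (hf : ∫ x, f x ∂μ = 0) :
    (leftSpectralGap Q μ - 1) * ‖f‖ ^ 2 ≤ ⟪f, transitionOp hrev f⟫ := by
  rcases eq_or_ne f 0 with rfl | hne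
  · simp
  have hpos : 0 < ‖f‖ := norm_pos_iff.2 hne
  have hint : ∀ g : S → ℝ, MemLp g 2 μ → |∫ z, g z.1 * g z.2 ∂(μ ⊗ₘ Q)| ≤ ∫ x, g x ^ 2 ∂μ := by
    intro g hg
    have h1 : ∫ z, g z.1 * g z.2 ∂(μ ⊗ₘ Q) = ⟪hg.toLp g, transitionOp hrev (hg.toLp g)⟫ := by
      rw [inner_transitionOp]
      refine integral_congr_ae ?_
      filter_upwards [(measurePreserving_fst_compProd (μ := μ) Q).quasiMeasurePreserving.ae_eq_comp
          hg.coeFn_toLp,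
        ((measurePreserving_fst_compProd (μ := μ) Q).comp hrev).quasiMeasurePreserving.ae_eq_comp
          hg.coeFn_toLp] with z hz1 hz2
      exact (congrArg₂ (· * ·) hz1 hz2).symm
    have h2 : ∫ x, g x ^ 2 ∂μ = ‖hg.toLp g‖ ^ 2 := by
      rw [← real_inner_self_eq_norm_sq, inner_Lp_two]
      refine integral_congr_ae ?_
      filter_upwards [hg.coeFn_toLp] with x hx
      rw [hx, sq]
    rw [h1, h2, sq]
    exact (abs_real_inner_le_norm _ _).trans
      (mul_le_mul_of_nonneg_left (norm_transitionOp_le hrev _) (norm_nonneg _))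
  have hnorm : ∫ x, f x ^ 2 ∂μ = ‖f‖ ^ 2 := by
    rw [← real_inner_self_eq_norm_sq, inner_Lp_two]
    simp only [sq]
  have hle : leftSpectralGap Q μ - 1 ≤ (‖f‖ ^ 2)⁻¹ * ⟪f, transitionOp hrev f⟫ := by
    rw [leftSpectralGap, add_sub_cancel_left]
    -- The real infimum is meaningful only on a set bounded below; contractivity supplies the bound
    -- −1. The member used is `f` normalised.
    refine csInf_le ⟨-1, ?_⟩ ⟨fun x => ‖f‖⁻¹ * f x, (Lp.memLp f).const_mul _, ?_, ?_, ?_⟩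
    · rintro a ⟨g, hg, -, hg1, rfl⟩
      exact (abs_le.1 ((hint g hg).trans_eq hg1)).1
    · rw [integral_const_mul, hf, mul_zero]
    · simp only [mul_pow]
      rw [integral_const_mul, hnorm, inv_pow, inv_mul_cancel₀ (by positivity)]
    · rw [inner_transitionOp, ← integral_const_mul]
      refine integral_congr_ae (.of_forall fun z => ?_)
      simp only [← inv_pow]
      ring
  have h3 := mul_le_mul_of_nonneg_right hle (sq_nonneg ‖f‖)
  rwa [mul_comm (‖f‖ ^ 2)⁻¹, inv_mul_cancel_right₀ (by positivity)] at h3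

theorem integral_transitionOp (hrev : MeasurePreserving Prod.swap (μ ⊗ₘ Q) (μ ⊗ₘ Q))
    (f : Lp ℝ 2 μ) : ∫ x, transitionOp hrev f x ∂μ = ∫ x, f x ∂μ := by
  have hint : Integrable (fun z : S × S => f z.2) (μ ⊗ₘ Q) := by
    simpa using integrable_mul_compProd hrev (memLp_const (1 : ℝ)) (Lp.memLp f)
  rw [integral_congr_ae (transitionOp_ae_eq hrev f), ← Measure.integral_compProd hint]
  exact integral_comp_measurePreserving ((measurePreserving_fst_compProd (μ := μ) Q).comp hrev)
    (Lp.memLp f).1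

theorem integral_transitionOp_pow (hrev : MeasurePreserving Prod.swap (μ ⊗ₘ Q) (μ ⊗ₘ Q))
    (k : ℕ) (f : Lp ℝ 2 μ) : ∫ x, (transitionOp hrev ^ k) f x ∂μ = ∫ x, f x ∂μ := by
  induction k with
  | zero => simp
  | succ k ih => rw [pow_succ', mul_apply_eq_comp, integral_transitionOp, ih]

theorem memLp_sub_integral {h : S → ℝ} (hh : MemLp h 2 μ) :
    MemLp (fun x => h x - ∫ t, h t ∂μ) 2 μ :=
  hh.sub (memLp_const _)

theorem evalIsometry_sum_ae_eq (hrev : MeasurePreserving Prod.swap (μ ⊗ₘ Q) (μ ⊗ₘ Q))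
    {g : S → ℝ} (hg : MemLp g 2 μ) (n : ℕ) :
    (∑ i ∈ Finset.range n, evalIsometry hrev i (hg.toLp g) : Lp ℝ 2 (chainLaw Q μ))
      =ᵐ[chainLaw Q μ] fun x => ∑ i ∈ Finset.range n, g (x i) := by
  have h1 : ∀ i, evalIsometry hrev i (hg.toLp g) =ᵐ[chainLaw Q μ] fun x => g (x i) := fun i =>
    (evalIsometry_ae_eq hrev i _).trans
      ((measurePreserving_eval_chainLaw hrev i).quasiMeasurePreserving.ae_eq_comp hg.coeFn_toLp)
  refine (Lp.coeFn_finsetSum _ _).trans ?_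
  filter_upwards [ae_all_iff.2 h1] with x hx
  rw [Finset.sum_apply]
  exact Finset.sum_congr rfl fun i _ => hx i

theorem scaledVariance_eq (hrev : MeasurePreserving Prod.swap (μ ⊗ₘ Q) (μ ⊗ₘ Q))
    {h : S → ℝ} (hh : MemLp h 2 μ) (n : ℕ) :
    scaledVariance Q μ h n = ENNReal.ofReal ((n : ℝ)⁻¹ *
      ‖∑ i ∈ Finset.range n, evalIsometry hrev i ((memLp_sub_integral hh).toLp _)‖ ^ 2) := by
  rcases Nat.eq_zero_or_pos n with rfl | hn
  · simp [scaledVariance]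
  have hn0 : (n : ℝ) ≠ 0 := by exact_mod_cast hn.ne'
  have hmean : ∀ i, ∫ x : ℕ → S, h (x i) ∂(chainLaw Q μ) = ∫ t, h t ∂μ := fun i =>
    integral_comp_measurePreserving (measurePreserving_eval_chainLaw hrev i) hh.1
  have hmean' : ∫ x : ℕ → S, 1 / (n : ℝ) * ∑ i ∈ Finset.range n, h (x i) ∂(chainLaw Q μ) =
      ∫ t, h t ∂μ := by
    rw [integral_const_mul, integral_finsetSum]
    · simp only [hmean, Finset.sum_const, Finset.card_range, nsmul_eq_mul]
      field_simp
    · exact fun i _ => (hh.comp_measurePreserving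
        (measurePreserving_eval_chainLaw hrev i)).integrable one_le_two
  have hae := evalIsometry_sum_ae_eq hrev (memLp_sub_integral hh) n
  rw [scaledVariance, evariance, hmean', ENNReal.ofReal_mul (by positivity),
    ofReal_norm_sq_Lp_two]
  have h2 : ∀ x : ℕ → S, ‖1 / (n : ℝ) * ∑ i ∈ Finset.range n, h (x i) - ∫ t, h t ∂μ‖ₑ ^ 2 =
      ENNReal.ofReal ((n : ℝ)⁻¹ ^ 2) * ‖∑ i ∈ Finset.range n, (h (x i) - ∫ t, h t ∂μ)‖ₑ ^ 2 := by
    intro x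
    have : 1 / (n : ℝ) * ∑ i ∈ Finset.range n, h (x i) - ∫ t, h t ∂μ =
        (n : ℝ)⁻¹ * ∑ i ∈ Finset.range n, (h (x i) - ∫ t, h t ∂μ) := by
      rw [Finset.sum_sub_distrib, Finset.sum_const, Finset.card_range, nsmul_eq_mul]
      field_simp
    rw [this, enorm_mul, mul_pow, ENNReal.ofReal_pow (by positivity),
      Real.enorm_of_nonneg (by positivity)]
  simp only [h2]
  rw [lintegral_const_mul' _ _ ENNReal.ofReal_ne_top, ← mul_assoc]
  congr 1
  · rw [← ENNReal.ofReal_natCast n, ← ENNReal.ofReal_mul (by positivity)]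
    congr 1
    field_simp
  · refine lintegral_congr_ae ?_
    filter_upwards [hae] with x hx
    rw [hx]

/-- Twice the Dirichlet form is the mean squared increment. -/
theorem dirichlet_eq (hrev : MeasurePreserving Prod.swap (μ ⊗ₘ Q) (μ ⊗ₘ Q)) {g : S → ℝ}
    (hg : MemLp g 2 μ) :
    2 * ⟪hg.toLp g, hg.toLp g - transitionOp hrev (hg.toLp g)⟫ =
      ∫ z, (g z.1 - g z.2) ^ 2 ∂(μ ⊗ₘ Q) := by
  have hm1 := measurePreserving_fst_compProd (μ := μ) Q
  have hm2 := hm1.comp hrev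
  have hg1 := hg.comp_measurePreserving hm1
  have hg2 := hg.comp_measurePreserving hm2
  have h1 : ∫ z, (g z.1 - g z.2) ^ 2 ∂(μ ⊗ₘ Q) = ∫ z, g z.1 ^ 2 ∂(μ ⊗ₘ Q) +
      ∫ z, g z.2 ^ 2 ∂(μ ⊗ₘ Q) - 2 * ∫ z, g z.1 * g z.2 ∂(μ ⊗ₘ Q) := by
    have hi1 : Integrable (fun z : S × S => g z.1 ^ 2) (μ ⊗ₘ Q) := hg1.integrable_sq
    have hi2 : Integrable (fun z : S × S => g z.2 ^ 2) (μ ⊗ₘ Q) := hg2.integrable_sq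
    have hi3 : Integrable (fun z : S × S => g z.1 ^ 2 + g z.2 ^ 2) (μ ⊗ₘ Q) := hi1.add hi2
    rw [← integral_const_mul, ← integral_add hi1 hi2,
      ← integral_sub hi3 ((integrable_mul_compProd hrev hg hg).const_mul 2)]
    exact integral_congr_ae (.of_forall fun z => by ring)
  have h2 : ⟪hg.toLp g, transitionOp hrev (hg.toLp g)⟫ = ∫ z, g z.1 * g z.2 ∂(μ ⊗ₘ Q) := by
    rw [inner_transitionOp]
    refine integral_congr_ae ?_
    filter_upwards [hm1.quasiMeasurePreserving.ae_eq_comp hg.coeFn_toLp,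
      hm2.quasiMeasurePreserving.ae_eq_comp hg.coeFn_toLp] with z hz1 hz2
    exact congrArg₂ (· * ·) hz1 hz2
  have h3 : ⟪hg.toLp g, hg.toLp g⟫ = ∫ x, g x ^ 2 ∂μ := by
    rw [inner_Lp_two]
    refine integral_congr_ae ?_
    filter_upwards [hg.coeFn_toLp] with x hx
    rw [hx, sq]
  have h4 : ∫ z, g z.1 ^ 2 ∂(μ ⊗ₘ Q) = ∫ x, g x ^ 2 ∂μ :=
    integral_comp_measurePreserving hm1 (hg.1.pow 2)
  have h5 : ∫ z, g z.2 ^ 2 ∂(μ ⊗ₘ Q) = ∫ x, g x ^ 2 ∂μ :=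
    integral_comp_measurePreserving hm2 (hg.1.pow 2)
  rw [h1, inner_sub_right, h2, h3, h4, h5]
  ring

/-- For a reversible chain with positive left spectral gap, the asymptotic variance exists, it
satisfies the variational lower bound, and it is at least the variance under the stationary
distribution if the transition operator is positive. -/
theorem exists_tendsto_scaledVariance
    (hrev : MeasurePreserving Prod.swap (μ ⊗ₘ Q) (μ ⊗ₘ Q)) (hgap : 0 < leftSpectralGap Q μ)
    {h : S → ℝ} (hh : MemLp h 2 μ) :
    ∃ V : ℝ≥0∞, Tendsto (scaledVariance Q μ h) atTop (𝓝 V) ∧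
      (V ≠ ∞ → ∀ g : S → ℝ, MemLp g 2 μ →
        4 * ∫ x, (h x - ∫ t, h t ∂μ) * g x ∂μ - ∫ z, (g z.1 - g z.2) ^ 2 ∂(μ ⊗ₘ Q) ≤
          V.toReal + ∫ x, (h x - ∫ t, h t ∂μ) ^ 2 ∂μ) ∧
      (1 ≤ leftSpectralGap Q μ → ENNReal.ofReal (∫ x, (h x - ∫ t, h t ∂μ) ^ 2 ∂μ) ≤ V) := by
  have hb := memLp_sub_integral hh
  have D := isDilation_evalIsometry hrev
  set u : Lp ℝ 2 μ := hb.toLp _ with hu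
  have hu0 : ∫ x, u x ∂μ = 0 := by
    rw [integral_congr_ae hb.coeFn_toLp, integral_sub (hh.integrable one_le_two)
      (integrable_const _)]
    simp
  have hun : ‖u‖ ^ 2 = ∫ x, (h x - ∫ t, h t ∂μ) ^ 2 ∂μ := by
    rw [← real_inner_self_eq_norm_sq, inner_Lp_two]
    refine integral_congr_ae ?_
    filter_upwards [hb.coeFn_toLp] with x hx
    rw [hu, hx, sq]
  have hgap' : ∀ m, (leftSpectralGap Q μ - 1) * ‖(transitionOp hrev ^ m) u‖ ^ 2 ≤
      ⟪(transitionOp hrev ^ m) u, transitionOp hrev ((transitionOp hrev ^ m) u)⟫ := fun m =>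
    leftSpectralGap_sub_one_le hrev ((integral_transitionOp_pow hrev m u).trans hu0)
  have hfun : scaledVariance Q μ h = fun n : ℕ => ENNReal.ofReal ((n : ℝ)⁻¹ *
      ‖∑ i ∈ Finset.range n, evalIsometry hrev i u‖ ^ 2) :=
    funext (scaledVariance_eq hrev hh)
  have hge : ∀ V : ℝ≥0∞, Tendsto (scaledVariance Q μ h) atTop (𝓝 V) →
      1 ≤ leftSpectralGap Q μ → ENNReal.ofReal (∫ x, (h x - ∫ t, h t ∂μ) ^ 2 ∂μ) ≤ V := by
    intro V hV h1
    refine ge_of_tendsto hV ?_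
    filter_upwards [eventually_gt_atTop 0] with n hn
    rw [hfun, ← hun]
    refine ENNReal.ofReal_le_ofReal ?_
    have hn' : (0 : ℝ) < n := by exact_mod_cast hn
    rw [inv_mul_eq_div, le_div_iff₀ hn', mul_comm]
    -- A gap of at least 1 makes the form ⟨v, Pv⟩ nonnegative on centred `v`, hence every
    -- autocovariance nonnegative.
    exact D.le_norm_sum_sq (fun m => (hgap' m).trans'
      (mul_nonneg (sub_nonneg.2 h1) (sq_nonneg _))) n
  rcases D.tendsto_norm_sum_sq hgap hgap' with ⟨V, hV⟩ | hV
  · have hV0 : 0 ≤ V := ge_of_tendsto' hV fun n => by positivity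
    have hlim : Tendsto (scaledVariance Q μ h) atTop (𝓝 (ENNReal.ofReal V)) := by
      rw [hfun]; exact ENNReal.tendsto_ofReal hV
    refine ⟨ENNReal.ofReal V, hlim, fun _ g hg => ?_, hge _ hlim⟩
    have hbound := D.variational_bound hV (hg.toLp g)
    have hd := dirichlet_eq hrev hg
    have hi : ⟪u, hg.toLp g⟫ = ∫ x, (h x - ∫ t, h t ∂μ) * g x ∂μ := by
      rw [inner_Lp_two]
      refine integral_congr_ae ?_
      filter_upwards [hb.coeFn_toLp, hg.coeFn_toLp] with x hx1 hx2
      rw [hu, hx1, hx2]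
    rw [hun, hi] at hbound
    rw [ENNReal.toReal_ofReal hV0]
    linarith
  · have hlim : Tendsto (scaledVariance Q μ h) atTop (𝓝 ∞) := by
      rw [hfun]; exact ENNReal.tendsto_ofReal_atTop.comp hV
    exact ⟨∞, hlim, fun hne => absurd rfl hne, hge _ hlim⟩

end AsymptoticVariance

/-! ### Accept-reject kernels -/

section AcceptReject

variable {S : Type*} [MeasurableSpace S] {κ : Kernel S S} [IsMarkovKernel κ] {α : S → S → ℝ≥0∞}

theorem lintegral_compProd_acceptReject (hα : Measurable (Function.uncurry α))
    (h1 : ∀ x y, α x y ≤ 1) (μ : Measure S) [SFinite μ] {F : S × S → ℝ≥0∞} (hF : Measurable F) :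
    ∫⁻ z, F z ∂(μ ⊗ₘ acceptReject κ α) =
      ∫⁻ x, ∫⁻ y, α x y * F (x, y) ∂(κ x) ∂μ +
        ∫⁻ x, (1 - ∫⁻ y, α x y ∂(κ x)) * F (x, x) ∂μ := by
  have := isMarkovKernel_acceptReject κ α hα h1
  have hacc : Measurable (fun x => ∫⁻ y, α x y ∂(κ x)) := hα.lintegral_kernel_prod_right
  have hm : Measurable (Function.uncurry
      (fun x (_ : S) => 1 - ∫⁻ y, α x y ∂(κ x) : S → S → ℝ≥0∞)) :=
    (measurable_const.sub hacc).comp measurable_fst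
  have hF' : Measurable (fun x => F (x, x)) := hF.comp (measurable_id.prodMk measurable_id)
  have hstay : Measurable fun x => (1 - ∫⁻ y, α x y ∂(κ x)) * F (x, x) :=
    (measurable_const.sub hacc).mul hF'
  rw [Measure.lintegral_compProd hF, ← lintegral_add_right _ hstay]
  refine lintegral_congr fun x => ?_
  have hFx : Measurable fun y => F (x, y) := hF.comp measurable_prodMk_left
  have hαx : Measurable (α x) := hα.comp measurable_prodMk_left
  rw [acceptReject, _root_.add_apply, lintegral_add_measure, Kernel.withDensity_apply _ hα,
    Kernel.withDensity_apply _ hm, lintegral_withDensity_eq_lintegral_mul _ hαx hFx,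
    lintegral_withDensity_eq_lintegral_mul _ measurable_const hFx, Kernel.id_apply,
    lintegral_dirac' _ (measurable_const.mul hFx)]
  rfl

/-- An accept-reject kernel whose accepted moves have a symmetric law is reversible. -/
theorem measurePreserving_swap_acceptReject (hα : Measurable (Function.uncurry α))
    (h1 : ∀ x y, α x y ≤ 1) (μ : Measure S) [SFinite μ]
    (hsymm : ∀ F : S × S → ℝ≥0∞, Measurable F →
      ∫⁻ x, ∫⁻ y, α x y * F (y, x) ∂(κ x) ∂μ = ∫⁻ x, ∫⁻ y, α x y * F (x, y) ∂(κ x) ∂μ) :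
    MeasurePreserving Prod.swap (μ ⊗ₘ acceptReject κ α) (μ ⊗ₘ acceptReject κ α) := by
  refine ⟨measurable_swap, Measure.ext_of_lintegral _ fun F hF => ?_⟩
  have hF' : Measurable fun z : S × S => F z.swap := hF.comp measurable_swap
  rw [lintegral_map hF measurable_swap, lintegral_compProd_acceptReject hα h1 μ hF',
    lintegral_compProd_acceptReject hα h1 μ hF, ← hsymm F hF]
  rfl

/-- The mean squared increment is controlled by the acceptance probability. -/
theorem lintegral_sq_sub_acceptReject_le (hα : Measurable (Function.uncurry α))
    (h1 : ∀ x y, α x y ≤ 1) (μ : Measure S) [SFinite μ]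
    (hsymm : ∀ F : S × S → ℝ≥0∞, Measurable F →
      ∫⁻ x, ∫⁻ y, α x y * F (y, x) ∂(κ x) ∂μ = ∫⁻ x, ∫⁻ y, α x y * F (x, y) ∂(κ x) ∂μ)
    {g : S → ℝ} (hg : Measurable g) :
    ∫⁻ z, ENNReal.ofReal ((g z.1 - g z.2) ^ 2) ∂(μ ⊗ₘ acceptReject κ α) ≤
      4 * ∫⁻ x, (∫⁻ y, α x y ∂(κ x)) * ENNReal.ofReal (g x ^ 2) ∂μ := by
  have hg2 : Measurable fun x => ENNReal.ofReal (g x ^ 2) := (hg.pow_const 2).ennreal_ofReal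
  have hacc : Measurable (fun x => ∫⁻ y, α x y ∂(κ x)) := hα.lintegral_kernel_prod_right
  have hfst : Measurable fun z : S × S => ENNReal.ofReal (g z.1 ^ 2) := hg2.comp measurable_fst
  have hprod : Measurable (Function.uncurry fun x y => α x y * ENNReal.ofReal (g x ^ 2)) :=
    hα.mul hfst
  have hself : ∫⁻ x, ∫⁻ y, α x y * ENNReal.ofReal (g x ^ 2) ∂(κ x) ∂μ =
      ∫⁻ x, (∫⁻ y, α x y ∂(κ x)) * ENNReal.ofReal (g x ^ 2) ∂μ :=
    lintegral_congr fun x => lintegral_mul_const _ (hα.comp measurable_prodMk_left)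
  have hother : ∫⁻ x, ∫⁻ y, α x y * ENNReal.ofReal (g y ^ 2) ∂(κ x) ∂μ =
      ∫⁻ x, (∫⁻ y, α x y ∂(κ x)) * ENNReal.ofReal (g x ^ 2) ∂μ := by
    rw [← hself]
    exact hsymm (fun z => ENNReal.ofReal (g z.1 ^ 2)) hfst
  have hincr : Measurable fun z : S × S => ENNReal.ofReal ((g z.1 - g z.2) ^ 2) :=
    (((hg.comp measurable_fst).sub (hg.comp measurable_snd)).pow_const 2).ennreal_ofReal
  rw [lintegral_compProd_acceptReject hα h1 μ hincr]
  -- Rejected moves sit on the diagonal, where the increment vanishes.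
  simp only [sub_self, ne_eq, OfNat.ofNat_ne_zero, not_false_eq_true, zero_pow,
    ENNReal.ofReal_zero, mul_zero, lintegral_zero, add_zero]
  calc ∫⁻ x, ∫⁻ y, α x y * ENNReal.ofReal ((g x - g y) ^ 2) ∂(κ x) ∂μ
      ≤ ∫⁻ x, ∫⁻ y, 2 * (α x y * ENNReal.ofReal (g x ^ 2)) +
          2 * (α x y * ENNReal.ofReal (g y ^ 2)) ∂(κ x) ∂μ := by
        refine lintegral_mono fun x => lintegral_mono fun y => ?_
        rw [mul_left_comm, mul_left_comm 2, ← mul_add]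
        refine mul_le_mul_right ?_ _
        rw [← ENNReal.ofReal_ofNat 2, ← ENNReal.ofReal_mul (by norm_num),
          ← ENNReal.ofReal_mul (by norm_num), ← ENNReal.ofReal_add (by positivity) (by positivity)]
        -- (a − b)² ≤ 2a² + 2b². By symmetry of the accepted moves both halves integrate to the same
        -- value, whence the factor 4.
        exact ENNReal.ofReal_le_ofReal (by nlinarith [sq_nonneg (g x + g y)])
    _ = 2 * ∫⁻ x, ∫⁻ y, α x y * ENNReal.ofReal (g x ^ 2) ∂(κ x) ∂μ +
          2 * ∫⁻ x, ∫⁻ y, α x y * ENNReal.ofReal (g y ^ 2) ∂(κ x) ∂μ := by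
        rw [← lintegral_const_mul' _ _ ENNReal.ofNat_ne_top,
          ← lintegral_const_mul' _ _ ENNReal.ofNat_ne_top,
          ← lintegral_add_left (hprod.lintegral_kernel_prod_right.const_mul 2)]
        refine lintegral_congr fun x => ?_
        rw [← lintegral_const_mul' _ _ ENNReal.ofNat_ne_top,
          ← lintegral_const_mul' _ _ ENNReal.ofNat_ne_top, ← lintegral_add_left]
        exact (hprod.comp measurable_prodMk_left).const_mul 2
    _ = 4 * ∫⁻ x, (∫⁻ y, α x y ∂(κ x)) * ENNReal.ofReal (g x ^ 2) ∂μ := by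
        rw [hself, hother, ← add_mul]
        norm_num

end AcceptReject

/-! ### The pseudo-marginal kernel: reversibility and the test function -/

namespace Model

variable {X : Type*} [MeasurableSpace X] {lam : Measure X} {W : Set ℝ≥0} (M : Model X lam W)

instance : IsProbabilityMeasure M.target :=
  ⟨by rw [target, withDensity_apply _ .univ, Measure.restrict_univ]; exact M.lintegral_dens⟩

theorem measurable_coe_noise : Measurable fun w : W => ((w : ℝ≥0) : ℝ≥0∞) :=
  measurable_coe_nnreal_ennreal.comp measurable_subtype_coe

theorem nu_apply (θ : X) : M.nu θ = (M.noise θ).withDensity fun w => ((w : ℝ≥0) : ℝ≥0∞) :=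
  Kernel.withDensity_apply (f := fun (_ : X) (w : W) => ((w : ℝ≥0) : ℝ≥0∞)) _
    (measurable_coe_noise.comp measurable_snd) θ

instance : IsMarkovKernel M.nu :=
  ⟨fun θ => ⟨by
    rw [nu_apply, withDensity_apply _ .univ, Measure.restrict_univ]; exact M.unbiased θ⟩⟩

instance : IsProbabilityMeasure M.stationary := by
  unfold stationary; infer_instance

theorem lintegral_stationary [SFinite lam] {F : X × W → ℝ≥0∞} (hF : Measurable F) :
    ∫⁻ z, F z ∂M.stationary =
      ∫⁻ z, (M.dens z.1 : ℝ≥0∞) * ((z.2 : ℝ≥0) : ℝ≥0∞) * F z ∂(lam ⊗ₘ M.noise) := by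
  have hd := M.measurable_dens.coe_nnreal_ennreal
  have hw := measurable_coe_noise (W := W)
  have hw' : Measurable fun z : X × W => ((z.2 : ℝ≥0) : ℝ≥0∞) := hw.comp measurable_snd
  have hin : Measurable fun θ => ∫⁻ w, ((w : ℝ≥0) : ℝ≥0∞) * F (θ, w) ∂(M.noise θ) :=
    Measurable.lintegral_kernel_prod_right (f := fun θ (w : W) => ((w : ℝ≥0) : ℝ≥0∞) * F (θ, w))
      (hw'.mul hF)
  have hnu : ∀ θ, ∫⁻ w, F (θ, w) ∂(M.nu θ) =
      ∫⁻ w, ((w : ℝ≥0) : ℝ≥0∞) * F (θ, w) ∂(M.noise θ) := fun θ => by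
    have hFθ : Measurable fun w => F (θ, w) := hF.comp measurable_prodMk_left
    rw [nu_apply, lintegral_withDensity_eq_lintegral_mul _ hw hFθ]
    rfl
  have hflux : Measurable fun z : X × W =>
      (M.dens z.1 : ℝ≥0∞) * ((z.2 : ℝ≥0) : ℝ≥0∞) * F z :=
    ((hd.comp measurable_fst).mul hw').mul hF
  rw [stationary, Measure.lintegral_compProd hF, Measure.lintegral_compProd hflux]
  simp only [hnu]
  rw [target, lintegral_withDensity_eq_lintegral_mul _ hd hin]
  refine lintegral_congr fun θ => ?_
  simp only [Pi.mul_apply, mul_assoc]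
  rw [lintegral_const_mul' _ _ ENNReal.coe_ne_top]

theorem lintegral_extendedProposal (z : X × W) {F : X × W → ℝ≥0∞} (hF : Measurable F) :
    ∫⁻ z', F z' ∂(M.extendedProposal z) =
      ∫⁻ θ', ∫⁻ w', F (θ', w') ∂(M.noise θ') ∂(M.proposal z.1) := by
  rw [extendedProposal, Kernel.comap_apply, Kernel.lintegral_compProd _ _ _ hF]
  rfl

theorem lintegral_extendedProposal_eq [SFinite lam] (z : X × W) {F : X × W → ℝ≥0∞}
    (hF : Measurable F) :
    ∫⁻ z', F z' ∂(M.extendedProposal z) =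
      ∫⁻ z', (M.q z.1 z'.1 : ℝ≥0∞) * F z' ∂(lam ⊗ₘ M.noise) := by
  have hq : Measurable fun θ' => (M.q z.1 θ' : ℝ≥0∞) :=
    (M.measurable_q.comp measurable_prodMk_left).coe_nnreal_ennreal
  have hin : Measurable fun θ' => ∫⁻ w', F (θ', w') ∂(M.noise θ') :=
    Measurable.lintegral_kernel_prod_right (f := fun θ' w' => F (θ', w')) hF
  have hqF : Measurable fun z' : X × W => (M.q z.1 z'.1 : ℝ≥0∞) * F z' :=
    (hq.comp measurable_fst).mul hF
  rw [lintegral_extendedProposal M z hF, Measure.lintegral_compProd hqF, M.proposal_eq,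
    lintegral_withDensity_eq_lintegral_mul _ hq hin]
  refine lintegral_congr fun θ' => ?_
  simp only [Pi.mul_apply]
  rw [lintegral_const_mul' _ _ ENNReal.coe_ne_top]

/-- Detailed balance: the accepted flux is a minimum symmetric in the two states. Where π(θ)q(θ'|θ)
or `w` vanishes, both sides are zero, so the value given to the ratio there is irrelevant. -/
theorem mul_accept (z z' : X × W) :
    (M.dens z.1 : ℝ≥0∞) * ((z.2 : ℝ≥0) : ℝ≥0∞) * (M.q z.1 z'.1 * M.accept z z') =
      min ((M.dens z.1 : ℝ≥0∞) * M.q z.1 z'.1 * ((z.2 : ℝ≥0) : ℝ≥0∞))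
        ((M.dens z'.1 : ℝ≥0∞) * M.q z'.1 z.1 * ((z'.2 : ℝ≥0) : ℝ≥0∞)) := by
  set a : ℝ≥0∞ := (M.dens z.1 : ℝ≥0∞) * M.q z.1 z'.1 with ha
  set b : ℝ≥0∞ := (M.dens z'.1 : ℝ≥0∞) * M.q z'.1 z.1 with hb
  set w : ℝ≥0∞ := ((z.2 : ℝ≥0) : ℝ≥0∞) with hw
  set w' : ℝ≥0∞ := ((z'.2 : ℝ≥0) : ℝ≥0∞)
  have hatop : a ≠ ∞ := ENNReal.mul_ne_top ENNReal.coe_ne_top ENNReal.coe_ne_top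
  have hwtop : w ≠ ∞ := ENNReal.coe_ne_top
  have hacc : M.accept z z' = min 1 (b / a * (w' / w)) := rfl
  have hL : (M.dens z.1 : ℝ≥0∞) * w * (M.q z.1 z'.1 * M.accept z z') =
      a * w * M.accept z z' := by rw [ha]; ring
  rw [hL, hacc]
  rcases eq_or_ne a 0 with h0 | h0
  · simp [h0]
  rcases eq_or_ne w 0 with h1 | h1
  · simp [h1]
  rw [mul_min, mul_one]
  congr 1
  calc a * w * (b / a * (w' / w)) = (a * a⁻¹) * (w * w⁻¹) * (b * w') := by
        simp only [div_eq_mul_inv]; ring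
    _ = b * w' := by
        rw [ENNReal.mul_inv_cancel h0 hatop, ENNReal.mul_inv_cancel h1 hwtop, one_mul, one_mul]

/-- With respect to two copies of dθ q̃_θ(dw), the accepted moves have a symmetric density, so
Tonelli exchanges the variables. -/
theorem lintegral_accept_swap [SFinite lam] (F : (X × W) × (X × W) → ℝ≥0∞) (hF : Measurable F) :
    ∫⁻ z, ∫⁻ z', M.accept z z' * F (z', z) ∂(M.extendedProposal z) ∂M.stationary =
      ∫⁻ z, ∫⁻ z', M.accept z z' * F (z, z') ∂(M.extendedProposal z) ∂M.stationary := by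
  let B : X × W → X × W → ℝ≥0∞ := fun z z' =>
    min ((M.dens z.1 : ℝ≥0∞) * M.q z.1 z'.1 * ((z.2 : ℝ≥0) : ℝ≥0∞))
      ((M.dens z'.1 : ℝ≥0∞) * M.q z'.1 z.1 * ((z'.2 : ℝ≥0) : ℝ≥0∞))
  have hflux : ∀ G : (X × W) × (X × W) → ℝ≥0∞, Measurable G →
      ∫⁻ z, ∫⁻ z', M.accept z z' * G (z, z') ∂(M.extendedProposal z) ∂M.stationary =
        ∫⁻ z, ∫⁻ z', B z z' * G (z, z') ∂(lam ⊗ₘ M.noise) ∂(lam ⊗ₘ M.noise) := by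
    intro G hG
    have hm : Measurable (Function.uncurry fun z z' => M.accept z z' * G (z, z')) :=
      M.measurable_accept.mul hG
    rw [lintegral_stationary M hm.lintegral_kernel_prod_right]
    refine lintegral_congr fun z => ?_
    have hmz : Measurable fun z' => M.accept z z' * G (z, z') := hm.of_uncurry_left
    rw [lintegral_extendedProposal_eq M z hmz,
      ← lintegral_const_mul' _ _ (ENNReal.mul_ne_top ENNReal.coe_ne_top ENNReal.coe_ne_top)]
    refine lintegral_congr fun z' => ?_
    simp only [B]
    rw [← mul_accept]
    ring
  have hBm : Measurable (Function.uncurry B) := by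
    have h1 := M.measurable_dens
    have h3 : Measurable (fun z : (X × W) × (X × W) => M.q z.1.1 z.2.1) :=
      M.measurable_q.comp (measurable_fst.fst.prodMk measurable_snd.fst)
    have h4 : Measurable (fun z : (X × W) × (X × W) => M.q z.2.1 z.1.1) :=
      M.measurable_q.comp (measurable_snd.fst.prodMk measurable_fst.fst)
    unfold Function.uncurry
    fun_prop
  rw [hflux F hF, hflux (fun z => F (z.2, z.1)) (hF.comp measurable_swap),
    lintegral_lintegral_swap]
  · refine lintegral_congr fun z => lintegral_congr fun z' => ?_
    rw [show B z' z = B z z' from min_comm _ _]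
  · exact (hBm.mul (hF.comp measurable_swap)).aemeasurable

theorem measurePreserving_swap_pmKernel [SFinite lam] :
    MeasurePreserving Prod.swap (M.stationary ⊗ₘ M.pmKernel) (M.stationary ⊗ₘ M.pmKernel) :=
  measurePreserving_swap_acceptReject M.measurable_accept (fun _ _ => min_le_left _ _) _
    M.lintegral_accept_swap

/-- Drop the minimum with 1 and integrate out the proposed noise, which has mean 1. This is the
stickiness at large `w`. -/
theorem lintegral_accept_le (z : X × W) :
    ∫⁻ z', M.accept z z' ∂(M.extendedProposal z) ≤
      M.meanRatio z.1 * ((z.2 : ℝ≥0) : ℝ≥0∞)⁻¹ := by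
  have hm : Measurable fun z' => M.accept z z' := M.measurable_accept.of_uncurry_left
  have hr : Measurable (M.ratio z.1) := by
    have h1 := M.measurable_dens
    have h3 : Measurable (fun θ' => M.q z.1 θ') :=
      M.measurable_q.comp (measurable_const.prodMk measurable_id)
    have h4 : Measurable (fun θ' => M.q θ' z.1) :=
      M.measurable_q.comp (measurable_id.prodMk measurable_const)
    unfold ratio
    fun_prop
  rw [lintegral_extendedProposal M z hm, meanRatio, ← lintegral_mul_const _ hr]
  refine lintegral_mono fun θ' => ?_
  calc ∫⁻ w', M.accept z (θ', w') ∂(M.noise θ')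
      ≤ ∫⁻ w', M.ratio z.1 θ' * ((z.2 : ℝ≥0) : ℝ≥0∞)⁻¹ * ((w' : ℝ≥0) : ℝ≥0∞) ∂(M.noise θ') := by
        refine lintegral_mono fun w' => (min_le_right _ _).trans_eq ?_
        rw [div_eq_mul_inv]
        ring
    _ = M.ratio z.1 θ' * ((z.2 : ℝ≥0) : ℝ≥0∞)⁻¹ := by
        rw [lintegral_const_mul _ measurable_coe_noise, M.unbiased, mul_one]

theorem measurePreserving_fst_stationary : MeasurePreserving Prod.fst M.stationary M.target :=
  ⟨measurable_fst, Measure.fst_compProd M.target M.nu⟩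

/-- This is where independence of the noise law from `θ` enters: the stationary law is then a
product. -/
theorem lintegral_mul_stationary {qt : Measure W} (hqt : ∀ θ, M.noise θ = qt)
    {a : X → ℝ≥0∞} (ha : Measurable a) {b : W → ℝ≥0∞} (hb : Measurable b) :
    ∫⁻ z, a z.1 * b z.2 ∂M.stationary =
      (∫⁻ θ, a θ ∂M.target) * ∫⁻ w, ((w : ℝ≥0) : ℝ≥0∞) * b w ∂qt := by
  have hab : Measurable fun z : X × W => a z.1 * b z.2 :=
    (ha.comp measurable_fst).mul (hb.comp measurable_snd)
  rw [stationary, Measure.lintegral_compProd hab, ← lintegral_mul_const _ ha]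
  refine lintegral_congr fun θ => ?_
  dsimp only
  rw [lintegral_const_mul _ hb, nu_apply, hqt,
    lintegral_withDensity_eq_lintegral_mul _ measurable_coe_noise hb]
  rfl

theorem acceptance_mul_le {c : ℝ} (hc : 0 < c) {z : X × W}
    (hz : M.meanRatio z.1 ≤ ENNReal.ofReal c) {N : ℝ} (hN : 0 ≤ N) (u : ℝ) :
    4 * ((∫⁻ z', M.accept z z' ∂(M.extendedProposal z)) *
      ENNReal.ofReal ((u * (min ((z.2 : ℝ≥0) : ℝ) N / (2 * c))) ^ 2)) ≤
      ENNReal.ofReal (1 / c * (u ^ 2 * min ((z.2 : ℝ≥0) : ℝ) N)) := by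
  -- At w = 0 the bound c/w is useless, but the test function vanishes there.
  rcases eq_or_lt_of_le (z.2 : ℝ≥0).coe_nonneg with hw | hw
  · rw [← hw]
    simp [hN]
  have hw' : 0 < (z.2 : ℝ≥0) := by exact_mod_cast hw
  set w : ℝ := ((z.2 : ℝ≥0) : ℝ) with hwdef
  have hm0 : 0 ≤ min w N := le_min hw.le hN
  have hinv : ((z.2 : ℝ≥0) : ℝ≥0∞)⁻¹ = ENNReal.ofReal w⁻¹ := by
    rw [ENNReal.ofReal_inv_of_pos hw, hwdef, ENNReal.ofReal_coe_nnreal]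
  have hacc : ∫⁻ z', M.accept z z' ∂(M.extendedProposal z) ≤ ENNReal.ofReal (c * w⁻¹) := by
    rw [ENNReal.ofReal_mul hc.le, ← hinv]
    exact (M.lintegral_accept_le z).trans (mul_le_mul_left hz _)
  calc 4 * ((∫⁻ z', M.accept z z' ∂(M.extendedProposal z)) *
        ENNReal.ofReal ((u * (min w N / (2 * c))) ^ 2))
      ≤ 4 * (ENNReal.ofReal (c * w⁻¹) * ENNReal.ofReal ((u * (min w N / (2 * c))) ^ 2)) := by
        gcongr
    _ = ENNReal.ofReal (4 * (c * w⁻¹ * (u * (min w N / (2 * c))) ^ 2)) := by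
        rw [ENNReal.ofReal_mul (by norm_num : (0 : ℝ) ≤ 4),
          ENNReal.ofReal_mul (by positivity : 0 ≤ c * w⁻¹), ENNReal.ofReal_ofNat]
    _ ≤ ENNReal.ofReal (1 / c * (u ^ 2 * min w N)) := by
        refine ENNReal.ofReal_le_ofReal ?_
        have h1 : 4 * (c * w⁻¹ * (u * (min w N / (2 * c))) ^ 2) =
            1 / c * (u ^ 2 * (min w N * (min w N / w))) := by
          field_simp
          ring
        rw [h1]
        -- One factor min(w,N) of the square is absorbed by the 1/w of the acceptance bound.
        have h2 : min w N / w ≤ 1 := (div_le_one hw).2 (min_le_left _ _)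
        gcongr
        exact mul_le_of_le_one_right hm0 h2

theorem truncated_second_moment_le [SFinite lam] {qt : Measure W} (hqt : ∀ θ, M.noise θ = qt)
    {h : X → ℝ} (hh : MemLp h 2 M.target) {c : ℝ} (hc : 0 < c)
    (hr : ∀ᵐ θ ∂M.target, M.meanRatio θ ≤ ENNReal.ofReal c) {V : ℝ}
    (hV : ∀ g : X × W → ℝ, MemLp g 2 M.stationary →
      4 * ∫ z, (h z.1 - ∫ t, h t ∂M.target) * g z ∂M.stationary -
        ∫ y, (g y.1 - g y.2) ^ 2 ∂(M.stationary ⊗ₘ M.pmKernel) ≤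
          V + ∫ θ, (h θ - ∫ t, h t ∂M.target) ^ 2 ∂M.target) {N : ℝ} (hN : 0 ≤ N) :
    ENNReal.ofReal (∫ θ, (h θ - ∫ t, h t ∂M.target) ^ 2 ∂M.target) *
      ∫⁻ w, ((w : ℝ≥0) : ℝ≥0∞) * ENNReal.ofReal (min ((w : ℝ≥0) : ℝ) N) ∂qt ≤
    ENNReal.ofReal (c * (V + ∫ θ, (h θ - ∫ t, h t ∂M.target) ^ 2 ∂M.target)) := by
  have hb := memLp_sub_integral hh
  set E : ℝ := ∫ θ, (h θ - ∫ t, h t ∂M.target) ^ 2 ∂M.target with hE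
  obtain ⟨u, hum, hu⟩ : ∃ u : X → ℝ, Measurable u ∧
      (fun θ => h θ - ∫ t, h t ∂M.target) =ᵐ[M.target] u :=
    ⟨hb.1.aemeasurable.mk _, hb.1.aemeasurable.measurable_mk, hb.1.aemeasurable.ae_eq_mk⟩
  have hu2 : MemLp u 2 M.target := hb.ae_eq hu
  have hfst := M.measurePreserving_fst_stationary
  have hu2' : MemLp (fun z : X × W => u z.1) 2 M.stationary := hu2.comp_measurePreserving hfst
  have hφm : Measurable fun w : W => min ((w : ℝ≥0) : ℝ) N := by fun_prop
  have hφ0 : ∀ w : W, 0 ≤ min ((w : ℝ≥0) : ℝ) N := fun w => le_min NNReal.zero_le_coe hN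
  have hbdd : ∀ r : ℝ, MemLp (fun z : X × W => u z.1 * (min ((z.2 : ℝ≥0) : ℝ) N / r)) 2
      M.stationary := by
    intro r
    have hmeas : Measurable fun z : X × W => u z.1 * (min ((z.2 : ℝ≥0) : ℝ) N / r) :=
      (hum.comp measurable_fst).mul ((hφm.comp measurable_snd).div_const r)
    refine hu2'.of_le_mul (c := N / |r|) hmeas.aestronglyMeasurable (.of_forall fun z => ?_)
    rw [norm_mul, mul_comm, norm_div, Real.norm_of_nonneg (hφ0 _), Real.norm_eq_abs r]
    gcongr
    exact min_le_right _ _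
  have hJint : Integrable (fun z : X × W => u z.1 ^ 2 * min ((z.2 : ℝ≥0) : ℝ) N)
      M.stationary := by
    refine (hu2'.integrable_mul (hbdd 1)).congr (.of_forall fun z => ?_)
    simp only [Pi.mul_apply, div_one]
    ring
  set J : ℝ := ∫ z, u z.1 ^ 2 * min ((z.2 : ℝ≥0) : ℝ) N ∂M.stationary with hJ
  have hJ0 : 0 ≤ J := integral_nonneg fun z => mul_nonneg (sq_nonneg _) (hφ0 _)
  have hEl : ENNReal.ofReal E = ∫⁻ θ, ENNReal.ofReal (u θ ^ 2) ∂M.target := by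
    rw [← ofReal_integral_eq_lintegral_ofReal hu2.integrable_sq (.of_forall fun θ => sq_nonneg _)]
    refine congrArg _ (integral_congr_ae ?_)
    filter_upwards [hu] with θ hθ
    rw [hθ]
  have hJl : ENNReal.ofReal J = ENNReal.ofReal E *
      ∫⁻ w, ((w : ℝ≥0) : ℝ≥0∞) * ENNReal.ofReal (min ((w : ℝ≥0) : ℝ) N) ∂qt := by
    rw [hEl, ← M.lintegral_mul_stationary hqt (hum.pow_const 2).ennreal_ofReal hφm.ennreal_ofReal,
      ofReal_integral_eq_lintegral_ofReal hJint
        (.of_forall fun z => mul_nonneg (sq_nonneg _) (hφ0 _))]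
    exact lintegral_congr fun z => ENNReal.ofReal_mul (sq_nonneg _)
  rw [← hJl]
  refine ENNReal.ofReal_le_ofReal ?_
  -- Truncation at `N` keeps `g` in L². With scale `t` in front of u·min(w,N), the bound is 4tJ −
  -- 4ct²J, largest at t = 1/(2c) with value J/c.
  let g : X × W → ℝ := fun z => u z.1 * (min ((z.2 : ℝ≥0) : ℝ) N / (2 * c))
  have hgm : Measurable g :=
    (hum.comp measurable_fst).mul ((hφm.comp measurable_snd).div_const _)
  have hg : MemLp g 2 M.stationary := hbdd (2 * c)
  have hcross : 4 * ∫ z, (h z.1 - ∫ t, h t ∂M.target) * g z ∂M.stationary = 2 / c * J := by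
    rw [hJ, ← integral_const_mul, ← integral_const_mul]
    refine integral_congr_ae ?_
    filter_upwards [hfst.quasiMeasurePreserving.ae_eq_comp hu] with z hz
    have hz' : h z.1 - ∫ t, h t ∂M.target = u z.1 := hz
    rw [hz']
    simp only [g]
    field_simp
    ring
  have hrev := M.measurePreserving_swap_pmKernel
  have hm1 := measurePreserving_fst_compProd (μ := M.stationary) M.pmKernel
  have hincr : Integrable (fun y : (X × W) × (X × W) => (g y.1 - g y.2) ^ 2)
      (M.stationary ⊗ₘ M.pmKernel) :=
    ((hg.comp_measurePreserving hm1).sub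
      (hg.comp_measurePreserving (hm1.comp hrev))).integrable_sq
  have hdir : ∫ y, (g y.1 - g y.2) ^ 2 ∂(M.stationary ⊗ₘ M.pmKernel) ≤ 1 / c * J := by
    rw [← ENNReal.ofReal_le_ofReal_iff (by positivity),
      ofReal_integral_eq_lintegral_ofReal hincr (.of_forall fun y => sq_nonneg _), hJ,
      ← integral_const_mul, ofReal_integral_eq_lintegral_ofReal (hJint.const_mul _)
        (.of_forall fun z => mul_nonneg (by positivity) (mul_nonneg (sq_nonneg _) (hφ0 _)))]
    refine (lintegral_sq_sub_acceptReject_le M.measurable_accept (fun _ _ => min_le_left _ _) _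
      M.lintegral_accept_swap hgm).trans ?_
    rw [← lintegral_const_mul' _ _ ENNReal.ofNat_ne_top]
    refine lintegral_mono_ae ?_
    filter_upwards [hfst.quasiMeasurePreserving.ae hr] with z hz
    exact M.acceptance_mul_le hc hz hN _
  have hfin := hV g hg
  rw [hcross] at hfin
  have h1 : 1 / c * J ≤ V + E := by
    have h2 : 2 / c * J = 1 / c * J + 1 / c * J := by ring
    linarith
  rw [one_div, inv_mul_le_iff₀ hc] at h1
  exact h1

/-- The truncated bound is uniform in `N`; monotone convergence removes the truncation. -/
theorem second_moment_le [SFinite lam] {qt : Measure W} (hqt : ∀ θ, M.noise θ = qt)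
    {h : X → ℝ} (hh : MemLp h 2 M.target) {c : ℝ} (hc : 0 < c)
    (hr : ∀ᵐ θ ∂M.target, M.meanRatio θ ≤ ENNReal.ofReal c) {V : ℝ}
    (hV : ∀ g : X × W → ℝ, MemLp g 2 M.stationary →
      4 * ∫ z, (h z.1 - ∫ t, h t ∂M.target) * g z ∂M.stationary -
        ∫ y, (g y.1 - g y.2) ^ 2 ∂(M.stationary ⊗ₘ M.pmKernel) ≤
          V + ∫ θ, (h θ - ∫ t, h t ∂M.target) ^ 2 ∂M.target) :
    ENNReal.ofReal (∫ θ, (h θ - ∫ t, h t ∂M.target) ^ 2 ∂M.target) *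
      ∫⁻ w, ((w : ℝ≥0) : ℝ≥0∞) ^ 2 ∂qt ≤
    ENNReal.ofReal (c * (V + ∫ θ, (h θ - ∫ t, h t ∂M.target) ^ 2 ∂M.target)) := by
  have hlim : Tendsto (fun N : ℕ => ∫⁻ w, ((w : ℝ≥0) : ℝ≥0∞) *
      ENNReal.ofReal (min ((w : ℝ≥0) : ℝ) (N : ℝ)) ∂qt) atTop
      (𝓝 (∫⁻ w, ((w : ℝ≥0) : ℝ≥0∞) ^ 2 ∂qt)) := by
    refine lintegral_tendsto_of_tendsto_of_monotone (fun N => ?_) (.of_forall fun w => ?_)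
      (.of_forall fun w => ?_)
    · have hφm : Measurable fun w : W => min ((w : ℝ≥0) : ℝ) (N : ℝ) := by fun_prop
      exact (measurable_coe_noise.mul hφm.ennreal_ofReal).aemeasurable
    · intro N N' hNN
      have : (N : ℝ) ≤ N' := by exact_mod_cast hNN
      dsimp only
      gcongr
    · obtain ⟨n, hn⟩ := exists_nat_ge ((w : ℝ≥0) : ℝ)
      refine tendsto_const_nhds.congr' ?_
      filter_upwards [eventually_ge_atTop n] with N hN
      have : (n : ℝ) ≤ N := by exact_mod_cast hN
      rw [min_eq_left (hn.trans this), ENNReal.ofReal_coe_nnreal, sq]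
  exact le_of_tendsto' (ENNReal.Tendsto.const_mul hlim (Or.inr ENNReal.ofReal_ne_top))
    fun N => M.truncated_second_moment_le hqt hh hc hr hV N.cast_nonneg

end Model

end PseudoMarginal

end

/-! ### The main theorem -/

theorem mainTheorem5 {d : ℕ} (X : Set (EuclideanSpace ℝ (Fin d))) (hX : MeasurableSet X)
    (W : Set ℝ≥0)
    (M : PseudoMarginal.Model X ((volume : Measure (EuclideanSpace ℝ (Fin d))).comap (↑)) W)
    -- the law of the proposed noise does not depend on `θ`
    (qt : Measure W) (hqt : ∀ θ, M.noise θ = qt)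
    -- the left spectral gap
    (ε : ℝ) (hε : ε = PseudoMarginal.leftSpectralGap M.pmKernel M.stationary) (hε0 : 0 < ε)
    (h : X → ℝ) (hh : MemLp h 2 M.target)
    (c : ℝ) (hc : 0 < c) (hr : ∀ᵐ θ ∂M.target, M.meanRatio θ ≤ ENNReal.ofReal c) :
    -- the limit that defines the asymptotic variance exists in `[0, ∞]`
    Tendsto (PseudoMarginal.scaledVariance M.pmKernel M.stationary (fun z => h z.1)) atTop
        (𝓝 (PseudoMarginal.asymptoticVariance M.pmKernel M.stationary (fun z => h z.1))) ∧
    -- the lower bound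
    ((-(1 / ε) * ∫ θ, (h θ - ∫ t, h t ∂M.target) ^ 2 ∂M.target : ℝ) : EReal) +
        ((1 / (2 * c) * ∫ θ, (h θ - ∫ t, h t ∂M.target) ^ 2 ∂M.target : ℝ) : EReal) *
          ((∫⁻ w, ((w : ℝ≥0) : ℝ≥0∞) ^ 2 ∂qt : ℝ≥0∞) : EReal) ≤
      ((PseudoMarginal.asymptoticVariance M.pmKernel M.stationary (fun z => h z.1) : ℝ≥0∞) :
        EReal) ∧
    -- an infinite second moment of the noise forces an infinite asymptotic variance
    ((¬ ∃ a : ℝ, ∀ᵐ θ ∂M.target, h θ = a) →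
      ∫⁻ w, ((w : ℝ≥0) : ℝ≥0∞) ^ 2 ∂qt = ∞ →
      PseudoMarginal.asymptoticVariance M.pmKernel M.stationary (fun z => h z.1) = ∞) := by
  have : SFinite ((volume : Measure (EuclideanSpace ℝ (Fin d))).comap ((↑) : X → _)) := by
    have : SigmaFinite ((volume : Measure (EuclideanSpace ℝ (Fin d))).comap ((↑) : X → _)) :=
      SigmaFinite.of_map _ measurable_subtype_coe.aemeasurable
        (by rw [map_comap_subtype_coe hX]; infer_instance)
    infer_instance
  have hfst := M.measurePreserving_fst_stationary
  have hmean : ∫ z, h z.1 ∂M.stationary = ∫ t, h t ∂M.target :=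
    PseudoMarginal.integral_comp_measurePreserving hfst hh.1
  have hvar : ∫ z, (h z.1 - ∫ t, h t ∂M.target) ^ 2 ∂M.stationary =
      ∫ θ, (h θ - ∫ t, h t ∂M.target) ^ 2 ∂M.target :=
    PseudoMarginal.integral_comp_measurePreserving hfst
      (f := fun θ => (h θ - ∫ t, h t ∂M.target) ^ 2) ((hh.1.sub aestronglyMeasurable_const).pow 2)
  obtain ⟨V, hV, hbound, hpos⟩ := PseudoMarginal.exists_tendsto_scaledVariance
    M.measurePreserving_swap_pmKernel (hε ▸ hε0) (hh.comp_measurePreserving hfst)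
  simp only [Function.comp, hmean, hvar, ← hε] at hV hbound hpos
  have hasym : PseudoMarginal.asymptoticVariance M.pmKernel M.stationary (fun z => h z.1) = V :=
    hV.limUnder_eq
  rw [hasym]
  set E : ℝ := ∫ θ, (h θ - ∫ t, h t ∂M.target) ^ 2 ∂M.target with hE
  have hE0 : 0 ≤ E := integral_nonneg fun θ => sq_nonneg _
  have hkey : V ≠ ∞ → ENNReal.ofReal E * ∫⁻ w, ((w : ℝ≥0) : ℝ≥0∞) ^ 2 ∂qt ≤
      ENNReal.ofReal (c * (V.toReal + E)) := fun hne =>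
    M.second_moment_le hqt hh hc hr (hbound hne)
  refine ⟨hV, ?_, fun hconst htop => ?_⟩
  · rcases eq_or_ne V ∞ with rfl | hVtop
    · simp
    lift V to ℝ≥0 using hVtop
    -- For E = 0 the second moment may be infinite; the convention 0·∞ = 0 makes the left side zero.
    rcases hE0.eq_or_lt with hE1 | hE1
    · rw [← hE1]
      simpa using EReal.coe_ennreal_nonneg _
    have hs := hkey ENNReal.coe_ne_top
    have hS : ∫⁻ w, ((w : ℝ≥0) : ℝ≥0∞) ^ 2 ∂qt ≠ ∞ := by
      intro htop
      rw [htop, ENNReal.mul_top (ENNReal.ofReal_pos.2 hE1).ne', top_le_iff] at hs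
      exact ENNReal.ofReal_ne_top hs
    generalize ∫⁻ w, ((w : ℝ≥0) : ℝ≥0∞) ^ 2 ∂qt = S at hs hS ⊢
    lift S to ℝ≥0 using hS
    rw [← ENNReal.ofReal_coe_nnreal (p := S), ← ENNReal.ofReal_mul hE0, ENNReal.coe_toReal,
      ENNReal.ofReal_le_ofReal_iff (by positivity)] at hs
    have hreal : -(1 / ε) * E + 1 / (2 * c) * E * S ≤ V := by
      have h1 : 1 / (2 * c) * E * S ≤ (V + E) / 2 := by
        rw [div_mul_eq_mul_div, div_mul_eq_mul_div, one_mul, div_le_div_iff₀ (by positivity)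
          two_pos]
        linarith
      have hV0 : (0 : ℝ) ≤ V := V.coe_nonneg
      -- For ε ≥ 1 positivity gives E ≤ V, so (V + E)/2 ≤ V; for ε ≤ 1 the term E/ε ≥ E already
      -- absorbs E/2.
      rcases le_total 1 ε with h2 | h2
      · have h3 : E ≤ V := by
          have := hpos h2
          rwa [← ENNReal.ofReal_coe_nnreal (p := V), ENNReal.ofReal_le_ofReal_iff hV0] at this
        have h4 : 0 ≤ 1 / ε * E := by positivity
        linarith
      · have h3 : 1 ≤ 1 / ε := (one_le_div hε0).2 h2
        nlinarith
    rw [EReal.coe_nnreal_eq_coe_real, EReal.coe_nnreal_eq_coe_real]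
    exact_mod_cast hreal
  -- With `V` finite, E·∞ ≤ c(V + E) forces E = 0, so the function is almost everywhere its mean.
  · by_contra hne
    have hs := hkey hne
    rcases hE0.eq_or_lt with hE1 | hE1
    · refine hconst ⟨∫ t, h t ∂M.target, ?_⟩
      have h0 := (integral_eq_zero_iff_of_nonneg (fun θ => sq_nonneg _)
        (PseudoMarginal.memLp_sub_integral hh).integrable_sq).1 hE1.symm
      filter_upwards [h0] with θ hθ
      exact sub_eq_zero.1 (pow_eq_zero_iff two_ne_zero |>.1 hθ)
    · rw [htop, ENNReal.mul_top (ENNReal.ofReal_pos.2 hE1).ne', top_le_iff] at hs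
      exact ENNReal.ofReal_ne_top hs
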